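/- Let $K$ be a field of characteristic $0$ (e.g. $K=\mathbb{C}$) and let $(\mathfrak{g},\delta)$ be a finite dimensional Lie bialgebra over $K$. Let $\mathfrak{l}\subset\mathfrak{g}$ be a Lie subbialgebra and $\mathfrak{g}=\mathfrak{l}\oplus\mathfrak{u}$ a decomposition such that $[\mathfrak{l},\mathfrak{u}]\subset\mathfrak{u}$ and $\delta(\mathfrak{u})\subset(\mathfrak{l}\otimes\mathfrak{u})\oplus(\mathfrak{u}\otimes\mathfrak{l})\oplus(\mathfrak{u}\otimes\mathfrak{u})$. Assume that the splitting is nondegenerate: for generic $\lambda\in\mathfrak{l}^*$ the pairing $\mathfrak{u}\times\mathfrak{u}\to K$, $(u,v)\mapsto\lambda([u,v]_{\mathfrak{l}})$ is nondegenerate, where $z\mapsto z_{\mathfrak{l}}$ is the projection on $\mathfrak{l}$ parallel to $\mathfrak{u}$. Equip $\mathfrak{l}^*$, $\mathfrak{g}^*$ with the Lie brackets dual to the cobrackets; the splitting identifies $\mathfrak{l}^*$ with a Lie subalgebra of $\mathfrak{g}^*$ (extension of functionals by $0$ on $\mathfrak{u}$). Let $K[[L^*]]=U(\mathfrak{l}^*)^*$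 be the function algebra of the formal group $L^*$ of $\mathfrak{l}^*$. The group $L^*$ acts by $\mathrm{Ad}$ on the Drinfeld doubles $\mathfrak{d}(\mathfrak{g})=\mathfrak{g}\oplus\mathfrak{g}^*$ and $\mathfrak{d}(\mathfrak{l})=\mathfrak{l}\oplus\mathfrak{l}^*$. For $\varepsilon\in\mathfrak{l}^*$ set $(\mathbf{L}_\varepsilon f)(x)=\frac{d}{dt}\big|_{t=0}f(e^{-t\varepsilon}x)$ and $(\mathbf{R}_\varepsilon f)(x)=\frac{d}{dt}\big|_{t=0}f(xe^{t\varepsilon})$, and for $a\in\mathfrak{l}$ let $(\mathrm{dress}^L_a f)(x)=-(\mathbf{R}_{(\mathrm{Ad}(x^{-1})(a))_{\mathfrak{l}^*}}f)(x)$ be the left dressing action. These are derivations of $K[[L^*]]$, and they extend to its localizations. Let $\mathrm{d}^L(f)=-\sum_i e_i\otimes\mathbf{L}_{\varepsilon^i}(f)$, where $(e_i),(\varepsilon^i)$ are dual bases of $\mathfrak{l},\mathfrak{l}^*$, and $\mathrm{d}^L(a\otimes b\otimes \ell)=a\otimes b\otimes\mathrm{d}^L(\ell)$. Let $\mathrm{Alt}$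 denote the sum of the three cyclic permutations of a 3-tensor, let $\mathrm{CYB}(\rho)=[\rho^{1,2},\rho^{1,3}]+[\rho^{1,2},\rho^{2,3}]+[\rho^{1,3},\rho^{2,3}]$, and let $\wedge^2(V)\subset V^{\otimes 2}$ be the space of antisymmetric tensors. For $u,v\in\mathfrak{u}$ let $\omega(u,v)\in K[[L^*]]$ be the function $$x\mapsto \omega_x(u,v)=\big\langle(\mathrm{Ad}(x^{-1})(u))_{\mathfrak{g}},(\mathrm{Ad}(x^{-1})(v))_{\mathfrak{g}^*}\big\rangle ,$$ and let $P=\det\big(\omega(u_i,u_j)\big)_{i,j}\in K[[L^*]]$, where $(u_i)$ is a basis of $\mathfrak{u}$ ($P$ is well defined up to a nonzero scalar). Then $P\neq 0$, and there is a unique $\sigma=\sum_\alpha a_\alpha\otimes b_\alpha\otimes\ell_\alpha\in\mathfrak{u}\otimes\mathfrak{u}\otimes K[[L^*]][1/P]$ inverse to $\omega$, i.e. such that $\sum_\alpha a_\alpha\otimes\omega(v,b_\alpha)\ell_\alpha=v\otimes 1$ for all $v\in\mathfrak{u}$. This $\sigma$ lies in $\wedge^2(\mathfrak{u})\otimes K[[L^*]][1/P]$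 and is a Poisson-Lie dynamical $r$-matrix for $(L^*,\mathfrak{g},0)$, that is: (a) $\mathrm{dress}^L_a(\sigma)+[a\otimes 1+1\otimes a,\sigma]=0$ for all $a\in\mathfrak{l}$; (b) $\mathrm{CYB}(\sigma)+\mathrm{Alt}(\mathrm{d}^L\sigma)+\mathrm{Alt}((\delta\otimes\mathrm{id})(\sigma))=0$. -/

import Mathlib

open scoped TensorProduct
set_option linter.unusedSectionVars false

noncomputable section

namespace PLDyn

/-! ### Tensor operations -/

section Tensor

variable (K : Type*) [Field K] (V : Type*) [AddCommGroup V] [Module K V]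

/-- The cyclic permutation `a ⊗ b ⊗ c ↦ b ⊗ c ⊗ a`. -/
def cyc : V ⊗[K] (V ⊗[K] V) →ₗ[K] V ⊗[K] (V ⊗[K] V) :=
  (TensorProduct.assoc K V V V).toLinearMap ∘ₗ (TensorProduct.comm K V (V ⊗[K] V)).toLinearMap

/-- The sum of the cyclic permutations of a 3-tensor. -/
def alt : V ⊗[K] (V ⊗[K] V) →ₗ[K] V ⊗[K] (V ⊗[K] V) :=
  LinearMap.id + cyc K V + cyc K V ∘ₗ cyc K V

/-- `∧²(V)`, the space of antisymmetric tensors in `V ⊗ V`. -/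
def wedge2 : Submodule K (V ⊗[K] V) :=
  LinearMap.ker ((TensorProduct.comm K V V).toLinearMap + LinearMap.id)

variable {K V}

/-- For `f : V → V ⊗ V`, the map `f ⊗ id : V ⊗ V → V ⊗ V ⊗ V`. -/
def tensorId (f : V →ₗ[K] V ⊗[K] V) : V ⊗[K] V →ₗ[K] V ⊗[K] (V ⊗[K] V) :=
  (TensorProduct.assoc K V V V).toLinearMap ∘ₗ LinearMap.rTensor V f

theorem cyc_tmul (a b c : V) : cyc K V (a ⊗ₜ (b ⊗ₜ c)) = b ⊗ₜ (c ⊗ₜ a) := rfl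

theorem mem_wedge2 {t : V ⊗[K] V} : t ∈ wedge2 K V ↔ TensorProduct.comm K V V t = -t := by
  simp [wedge2, eq_neg_iff_add_eq_zero]

end Tensor

/-! ### Lie bialgebras -/

/-- A Lie bialgebra structure on a Lie algebra over a field. -/
class LieBialgebra (K g : Type*) [Field K] [LieRing g] [LieAlgebra K g] where
  /-- the cobracket `δ` -/
  cobracket : g →ₗ[K] g ⊗[K] g
  antisymm : ∀ a, cobracket a ∈ wedge2 K g
  coJacobi : ∀ a, alt K g (tensorId cobracket (cobracket a)) = 0
  /-- `δ([a,b]) = [a ⊗ 1 + 1 ⊗ a, δ(b)] + [δ(a), b ⊗ 1 + 1 ⊗ b]`; the bracket of `g` with `g ⊗ g`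
  is the diagonal adjoint action. -/
  cocycle : ∀ a b : g, cobracket ⁅a, b⁆ = ⁅a, cobracket b⁆ - ⁅b, cobracket a⁆

section Double

variable (K g : Type*) [Field K] [LieRing g] [LieAlgebra K g]

/-- The dual space `g^*`, to be equipped with the Lie bracket dual to the cobracket of `g`. -/
def LieDual : Type _ := Module.Dual K g

instance : AddCommGroup (LieDual K g) := inferInstanceAs (AddCommGroup (Module.Dual K g))
instance : Module K (LieDual K g) := inferInstanceAs (Module K (Module.Dual K g))
instance [Module.Finite K g] : Module.Finite K (LieDual K g) :=
  inferInstanceAs (Module.Finite K (Module.Dual K g))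

/-- The vector space `d(g) = g ⊕ g^*`, to be equipped with the bracket of the Drinfeld double. -/
def Double : Type _ := g × LieDual K g

instance : AddCommGroup (Double K g) := inferInstanceAs (AddCommGroup (g × LieDual K g))
instance : Module K (Double K g) := inferInstanceAs (Module K (g × LieDual K g))

variable {K g}

namespace LieDual

/-- The functional underlying an element of `g^*`. -/
def toDual : LieDual K g ≃ₗ[K] Module.Dual K g := LinearEquiv.refl K _

theorem ext {ξ η : LieDual K g} (h : ∀ x, toDual ξ x = toDual η x) : ξ = η :=
  LinearMap.ext h

end LieDual

open LieDual

section contractions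

/-- `a ⊗ b ↦ ξ(a) η(b)`. -/
def ev2 (ξ η : LieDual K g) : g ⊗[K] g →ₗ[K] K :=
  LinearMap.mul' K K ∘ₗ TensorProduct.map (toDual ξ) (toDual η)

/-- `a ⊗ b ↦ ξ(a) b`. -/
def ev1 (ξ : LieDual K g) : g ⊗[K] g →ₗ[K] g :=
  (TensorProduct.lid K g).toLinearMap ∘ₗ LinearMap.rTensor g (toDual ξ)

@[simp] theorem ev2_tmul (ξ η : LieDual K g) (a b : g) :
    ev2 ξ η (a ⊗ₜ b) = toDual ξ a * toDual η b := rfl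

@[simp] theorem ev1_tmul (ξ : LieDual K g) (a b : g) :
    ev1 ξ (a ⊗ₜ b) = toDual ξ a • b := rfl

/-- `a ⊗ b ⊗ c ↦ ξ(a) η(b) c`. -/
def ev12 (ξ η : LieDual K g) : g ⊗[K] (g ⊗[K] g) →ₗ[K] g :=
  ev1 η ∘ₗ (TensorProduct.lid K (g ⊗[K] g)).toLinearMap ∘ₗ
    LinearMap.rTensor (g ⊗[K] g) (toDual ξ)

@[simp] theorem ev12_tmul (ξ η : LieDual K g) (a b c : g) :
    ev12 ξ η (a ⊗ₜ (b ⊗ₜ c)) = (toDual ξ a * toDual η b) • c := by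
  simp [ev12, smul_smul]

end contractions

variable [LieBialgebra K g]

open LieBialgebra

/-- `⟨[ξ,η], x⟩ = ⟨ξ ⊗ η, δ(x)⟩`. -/
instance : Bracket (LieDual K g) (LieDual K g) where
  bracket ξ η := toDual.symm (ev2 ξ η ∘ₗ cobracket)

theorem LieDual.lie_apply (ξ η : LieDual K g) (x : g) :
    toDual ⁅ξ, η⁆ x = ev2 ξ η (cobracket x) := rfl

/-- The component in `g` of the bracket `[x, ξ]` in the double: `(ξ ⊗ id)(δ(x))`. -/
def coadG (x : g) (ξ : LieDual K g) : g := ev1 ξ (cobracket x)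

/-- The component in `g^*` of the bracket `[x, ξ]` in the double: `-ξ ∘ ad(x)`. -/
def coadD (x : g) (ξ : LieDual K g) : LieDual K g :=
  toDual.symm (-(toDual ξ ∘ₗ (LieAlgebra.ad K g x : g →ₗ[K] g)))

@[simp] theorem coadD_apply (x : g) (ξ : LieDual K g) (y : g) :
    toDual (coadD x ξ) y = - toDual ξ ⁅x, y⁆ := rfl

theorem toDual_ev1 (ξ η : LieDual K g) (t : g ⊗[K] g) :
    toDual η (ev1 ξ t) = ev2 ξ η t := by
  induction t with
  | zero => simp
  | tmul a b => simp
  | add s t hs ht => simp [hs, ht]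

theorem comm_cobracket (x : g) :
    TensorProduct.comm K g g (cobracket (K := K) x) = -cobracket x :=
  mem_wedge2.1 (antisymm x)

theorem ev2_comm (ξ η : LieDual K g) (t : g ⊗[K] g) :
    ev2 ξ η (TensorProduct.comm K g g t) = ev2 η ξ t := by
  induction t with
  | zero => simp
  | tmul a b => simp [mul_comm]
  | add s t hs ht => simp [hs, ht]

theorem ev2_cobracket_swap (ξ η : LieDual K g) (x : g) :
    ev2 ξ η (cobracket x) = - ev2 η ξ (cobracket x) := by
  rw [← ev2_comm, comm_cobracket, map_neg]

theorem ev2_add_left (ξ ξ' η : LieDual K g) (t : g ⊗[K] g) :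
    ev2 (ξ + ξ') η t = ev2 ξ η t + ev2 ξ' η t := by
  simp [ev2, TensorProduct.map_add_left]

theorem ev2_add_right (ξ η η' : LieDual K g) (t : g ⊗[K] g) :
    ev2 ξ (η + η') t = ev2 ξ η t + ev2 ξ η' t := by
  simp [ev2, TensorProduct.map_add_right]

theorem ev2_smul_left (c : K) (ξ η : LieDual K g) (t : g ⊗[K] g) :
    ev2 (c • ξ) η t = c * ev2 ξ η t := by
  simp [ev2, TensorProduct.map_smul_left]

theorem ev2_smul_right (c : K) (ξ η : LieDual K g) (t : g ⊗[K] g) :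
    ev2 ξ (c • η) t = c * ev2 ξ η t := by
  simp [ev2, TensorProduct.map_smul_right]

/-- The bracket of `g^*` contracted with the first slot of a tensor. -/
theorem ev1_lie (ξ η : LieDual K g) (t : g ⊗[K] g) :
    ev1 ⁅ξ, η⁆ t = ev12 ξ η (tensorId cobracket t) := by
  have key : ∀ (s : g ⊗[K] g) (b : g),
      ev12 ξ η (TensorProduct.assoc K g g g (s ⊗ₜ b)) = ev2 ξ η s • b := by
    intro s b
    induction s with
    | zero => simp
    | tmul a c => simp
    | add s t hs ht => rw [TensorProduct.add_tmul]; simp [hs, ht, add_smul]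
  induction t with
  | zero => simp
  | tmul a b => simp [tensorId, key, lie_apply]
  | add s t hs ht => simp [hs, ht]

theorem ev12_cyc (η ζ : LieDual K g) (s : g ⊗[K] g) (b : g) :
    ev12 η ζ (cyc K g (TensorProduct.assoc K g g g (s ⊗ₜ b))) =
      toDual ζ b • ev1 η (TensorProduct.comm K g g s) := by
  induction s with
  | zero => simp
  | tmul a c => simp [cyc_tmul, smul_smul, mul_comm]
  | add s t hs ht => rw [TensorProduct.add_tmul]; simp [hs, ht]

theorem ev12_cyc_cyc (η ζ : LieDual K g) (s : g ⊗[K] g) (b : g) :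
    ev12 η ζ (cyc K g (cyc K g (TensorProduct.assoc K g g g (s ⊗ₜ b)))) =
      toDual η b • ev1 ζ s := by
  induction s with
  | zero => simp
  | tmul a c => simp [cyc_tmul, smul_smul]
  | add s t hs ht => rw [TensorProduct.add_tmul]; simp [hs, ht]

theorem ev12_cyc_tensorId (η ζ : LieDual K g) (t : g ⊗[K] g) :
    ev12 η ζ (cyc K g (tensorId cobracket t)) =
      -ev1 η (cobracket (ev1 ζ (TensorProduct.comm K g g t))) := by
  induction t with
  | zero => simp
  | tmul a b => simp [tensorId, ev12_cyc, comm_cobracket]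
  | add s t hs ht => simp only [map_add, hs, ht]; abel

theorem ev12_cyc_cyc_tensorId (η ζ : LieDual K g) (t : g ⊗[K] g) :
    ev12 η ζ (cyc K g (cyc K g (tensorId cobracket t))) =
      ev1 ζ (cobracket (ev1 η (TensorProduct.comm K g g t))) := by
  induction t with
  | zero => simp
  | tmul a b => simp [tensorId, ev12_cyc_cyc]
  | add s t hs ht => simp only [map_add, hs, ht]

theorem coadG_lie_right (x : g) (η ζ : LieDual K g) :
    coadG x ⁅η, ζ⁆ = coadG (coadG x η) ζ - coadG (coadG x ζ) η := by
  have h := congrArg (ev12 η ζ) (coJacobi (K := K) x)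
  simp only [alt, LinearMap.add_apply, LinearMap.comp_apply, LinearMap.id_apply, map_add,
    map_zero, ev12_cyc_tensorId, ev12_cyc_cyc_tensorId, ← ev1_lie, comm_cobracket, map_neg,
    neg_neg] at h
  rw [← sub_eq_zero, ← h]
  simp only [coadG]
  abel

theorem ev1_lie_tensor (x : g) (ζ : LieDual K g) (t : g ⊗[K] g) :
    ev1 ζ ⁅x, t⁆ = ⁅x, ev1 ζ t⁆ - ev1 (coadD x ζ) t := by
  induction t with
  | zero => simp
  | tmul a b => simp [TensorProduct.LieModule.lie_tmul_right]; abel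
  | add s t hs ht => simp only [lie_add, map_add, hs, ht]; abel

theorem ev2_lie_tensor (x : g) (η ζ : LieDual K g) (t : g ⊗[K] g) :
    ev2 η ζ ⁅x, t⁆ = - ev2 (coadD x η) ζ t - ev2 η (coadD x ζ) t := by
  induction t with
  | zero => simp
  | tmul a b => simp [TensorProduct.LieModule.lie_tmul_right]
  | add s t hs ht => simp only [lie_add, map_add, hs, ht]; ring

theorem coadG_lie_left (x y : g) (ζ : LieDual K g) :
    coadG ⁅x, y⁆ ζ = ⁅x, coadG y ζ⁆ - ⁅y, coadG x ζ⁆ + coadG x (coadD y ζ)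
      - coadG y (coadD x ζ) := by
  simp only [coadG, cocycle, map_sub, ev1_lie_tensor]
  abel

theorem coadD_lie_left (x y : g) (ζ : LieDual K g) :
    coadD ⁅x, y⁆ ζ = coadD x (coadD y ζ) - coadD y (coadD x ζ) := by
  apply LieDual.ext
  intro z
  simp [lie_lie]

theorem coadD_lie_right (x : g) (η ζ : LieDual K g) :
    coadD x ⁅η, ζ⁆ = ⁅coadD x η, ζ⁆ + ⁅η, coadD x ζ⁆ + coadD (coadG x η) ζ
      - coadD (coadG x ζ) η := by
  apply LieDual.ext
  intro y
  have h1 : toDual ζ ⁅coadG x η, y⁆ = - ev2 η (toDual.symm (toDual ζ ∘ₗ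
      (LieAlgebra.ad K g y : g →ₗ[K] g))) (cobracket x) := by
    rw [← toDual_ev1, ← lie_skew, map_neg]; rfl
  have h2 : toDual η ⁅coadG x ζ, y⁆ = - ev2 ζ (toDual.symm (toDual η ∘ₗ
      (LieAlgebra.ad K g y : g →ₗ[K] g))) (cobracket x) := by
    rw [← toDual_ev1, ← lie_skew, map_neg]; rfl
  have e1 : (toDual.symm (toDual ζ ∘ₗ (LieAlgebra.ad K g y : g →ₗ[K] g))) = (-1 : K) • coadD y ζ := by
    apply LieDual.ext; intro z; simp
  have e2 : (toDual.symm (toDual η ∘ₗ (LieAlgebra.ad K g y : g →ₗ[K] g))) = (-1 : K) • coadD y η := by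
    apply LieDual.ext; intro z; simp
  rw [e1, ev2_smul_right] at h1
  rw [e2, ev2_smul_right, ev2_cobracket_swap] at h2
  simp only [map_add, map_sub, LinearMap.add_apply, LinearMap.sub_apply, coadD_apply,
    LieDual.lie_apply, cocycle, ev2_lie_tensor, h1, h2]
  ring

variable [CharZero K]

theorem LieDual.lie_self' (ξ : LieDual K g) : ⁅ξ, ξ⁆ = 0 := by
  apply LieDual.ext
  intro x
  have := ev2_cobracket_swap ξ ξ x
  rw [LieDual.lie_apply, map_zero, LinearMap.zero_apply]
  exact self_eq_neg.1 this

theorem LieDual.lie_skew' (ξ η : LieDual K g) : ⁅ξ, η⁆ = -⁅η, ξ⁆ := by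
  apply LieDual.ext
  intro x
  rw [map_neg, LinearMap.neg_apply, LieDual.lie_apply, LieDual.lie_apply, ev2_cobracket_swap]

/-- The Lie bracket on `g^*` dual to the cobracket of `g`. -/
instance : LieRing (LieDual K g) where
  add_lie ξ η ζ := by
    apply LieDual.ext; intro x; simp [LieDual.lie_apply, ev2_add_left]
  lie_add ξ η ζ := by
    apply LieDual.ext; intro x; simp [LieDual.lie_apply, ev2_add_right]
  lie_self := LieDual.lie_self'
  leibniz_lie ξ η ζ := by
    apply LieDual.ext
    intro x
    have h := congrArg (toDual ζ) (coadG_lie_right x ξ η)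
    simp only [coadG, toDual_ev1, map_sub, ← LieDual.lie_apply] at h
    simp only [map_add, LinearMap.add_apply, LieDual.lie_apply] at h ⊢
    rw [h]
    simp only [← LieDual.lie_apply]
    ring

instance : LieAlgebra K (LieDual K g) where
  lie_smul c ξ η := by
    apply LieDual.ext; intro x; simp [LieDual.lie_apply, ev2_smul_right]

namespace Double

/-- The projection `d(g) → g`. -/
def fst : Double K g →ₗ[K] g := LinearMap.fst K g (LieDual K g)

/-- The projection `d(g) → g^*`. -/
def snd : Double K g →ₗ[K] LieDual K g := LinearMap.snd K g (LieDual K g)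

/-- The inclusion `g → d(g)`. -/
def inl : g →ₗ[K] Double K g := LinearMap.inl K g (LieDual K g)

theorem ext {v w : Double K g} (h₁ : fst v = fst w) (h₂ : snd v = snd w) : v = w :=
  Prod.ext h₁ h₂

/-- The bracket of the Drinfeld double. It extends the brackets of `g` and of `g^*`, and its mixed
brackets are the ones for which the canonical bilinear form is invariant. -/
instance : Bracket (Double K g) (Double K g) where
  bracket v w := (⁅fst v, fst w⁆ + coadG (fst v) (snd w) - coadG (fst w) (snd v),
    ⁅snd v, snd w⁆ + coadD (fst v) (snd w) - coadD (fst w) (snd v))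

theorem fst_lie (v w : Double K g) : fst ⁅v, w⁆ =
    ⁅fst v, fst w⁆ + coadG (fst v) (snd w) - coadG (fst w) (snd v) := rfl

theorem snd_lie (v w : Double K g) : snd ⁅v, w⁆ =
    ⁅snd v, snd w⁆ + coadD (fst v) (snd w) - coadD (fst w) (snd v) := rfl

end Double

theorem coadG_add_left (x y : g) (ξ : LieDual K g) : coadG (x + y) ξ = coadG x ξ + coadG y ξ := by
  simp [coadG]

theorem coadG_add_right (x : g) (ξ η : LieDual K g) :
    coadG x (ξ + η) = coadG x ξ + coadG x η := by
  simp [coadG, ev1, LinearMap.rTensor_add]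

theorem coadG_smul_left (c : K) (x : g) (ξ : LieDual K g) : coadG (c • x) ξ = c • coadG x ξ := by
  simp [coadG]

theorem coadG_smul_right (c : K) (x : g) (ξ : LieDual K g) : coadG x (c • ξ) = c • coadG x ξ := by
  simp [coadG, ev1, LinearMap.rTensor_smul]

theorem coadD_add_left (x y : g) (ξ : LieDual K g) : coadD (x + y) ξ = coadD x ξ + coadD y ξ := by
  apply LieDual.ext; intro z; simp; ring

theorem coadD_add_right (x : g) (ξ η : LieDual K g) :
    coadD x (ξ + η) = coadD x ξ + coadD x η := by
  apply LieDual.ext; intro z; simp; ring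

theorem coadD_smul_left (c : K) (x : g) (ξ : LieDual K g) : coadD (c • x) ξ = c • coadD x ξ := by
  apply LieDual.ext; intro z; simp

theorem coadD_smul_right (c : K) (x : g) (ξ : LieDual K g) : coadD x (c • ξ) = c • coadD x ξ := by
  apply LieDual.ext; intro z; simp

theorem coadG_sub_left (x y : g) (ξ : LieDual K g) : coadG (x - y) ξ = coadG x ξ - coadG y ξ := by
  simp [coadG]

theorem coadG_sub_right (x : g) (ξ η : LieDual K g) :
    coadG x (ξ - η) = coadG x ξ - coadG x η := by
  simp [coadG, ev1, LinearMap.rTensor_sub]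

theorem coadD_sub_left (x y : g) (ξ : LieDual K g) : coadD (x - y) ξ = coadD x ξ - coadD y ξ := by
  apply LieDual.ext; intro z; simp; ring

theorem coadD_sub_right (x : g) (ξ η : LieDual K g) :
    coadD x (ξ - η) = coadD x ξ - coadD x η := by
  apply LieDual.ext; intro z; simp; ring

theorem Double.leibniz_fst (x y z : g) (ξ η ζ : LieDual K g) :
    ⁅x, ⁅y, z⁆ + coadG y ζ - coadG z η⁆ + coadG x (⁅η, ζ⁆ + coadD y ζ - coadD z η)
        - coadG (⁅y, z⁆ + coadG y ζ - coadG z η) ξ =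
      (⁅⁅x, y⁆ + coadG x η - coadG y ξ, z⁆ + coadG (⁅x, y⁆ + coadG x η - coadG y ξ) ζ
        - coadG z (⁅ξ, η⁆ + coadD x η - coadD y ξ)) +
      (⁅y, ⁅x, z⁆ + coadG x ζ - coadG z ξ⁆ + coadG y (⁅ξ, ζ⁆ + coadD x ζ - coadD z ξ)
        - coadG (⁅x, z⁆ + coadG x ζ - coadG z ξ) η) := by
  simp only [lie_add, add_lie, lie_sub, sub_lie, coadG_add_left, coadG_add_right, coadG_sub_left,
    coadG_sub_right, coadG_lie_left, coadG_lie_right]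
  rw [leibniz_lie x y z, ← lie_skew (coadG x η) z, ← lie_skew (coadG y ξ) z]
  abel

theorem Double.leibniz_snd (x y z : g) (ξ η ζ : LieDual K g) :
    ⁅ξ, ⁅η, ζ⁆ + coadD y ζ - coadD z η⁆ + coadD x (⁅η, ζ⁆ + coadD y ζ - coadD z η)
        - coadD (⁅y, z⁆ + coadG y ζ - coadG z η) ξ =
      (⁅⁅ξ, η⁆ + coadD x η - coadD y ξ, ζ⁆ + coadD (⁅x, y⁆ + coadG x η - coadG y ξ) ζ
        - coadD z (⁅ξ, η⁆ + coadD x η - coadD y ξ)) +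
      (⁅η, ⁅ξ, ζ⁆ + coadD x ζ - coadD z ξ⁆ + coadD y (⁅ξ, ζ⁆ + coadD x ζ - coadD z ξ)
        - coadD (⁅x, z⁆ + coadG x ζ - coadG z ξ) η) := by
  simp only [lie_add, add_lie, lie_sub, sub_lie, coadD_add_left, coadD_add_right, coadD_sub_left,
    coadD_sub_right, coadD_lie_left, coadD_lie_right]
  rw [leibniz_lie ξ η ζ, ← lie_skew (coadD z ξ) η]
  abel

/-- The Drinfeld double is a Lie algebra. -/
instance : LieRing (Double K g) where
  add_lie u v w := by
    apply Double.ext <;> simp only [Double.fst_lie, Double.snd_lie, map_add, add_lie,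
      coadG_add_left, coadG_add_right, coadD_add_left, coadD_add_right] <;> abel
  lie_add u v w := by
    apply Double.ext <;> simp only [Double.fst_lie, Double.snd_lie, map_add, lie_add,
      coadG_add_left, coadG_add_right, coadD_add_left, coadD_add_right] <;> abel
  lie_self v := by
    apply Double.ext <;> simp [Double.fst_lie, Double.snd_lie]
  leibniz_lie u v w := Double.ext
    (Double.leibniz_fst (Double.fst u) (Double.fst v) (Double.fst w)
      (Double.snd u) (Double.snd v) (Double.snd w))
    (Double.leibniz_snd (Double.fst u) (Double.fst v) (Double.fst w)
      (Double.snd u) (Double.snd v) (Double.snd w))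

instance : LieAlgebra K (Double K g) where
  lie_smul c v w := by
    apply Double.ext <;> simp only [Double.fst_lie, Double.snd_lie, map_smul, lie_smul,
      coadG_smul_left, coadG_smul_right, coadD_smul_left, coadD_smul_right, smul_add, smul_sub]

/-- The inclusion of Lie algebras `g^* → d(g)`. -/
def Double.inr : LieDual K g →ₗ⁅K⁆ Double K g :=
  { LinearMap.inr K g (LieDual K g) with
    map_lie' := by
      intro ξ η
      apply Double.ext
      · change (0 : g) = ⁅(0 : g), (0 : g)⁆ + coadG 0 η - coadG 0 ξ
        simp [coadG]
      · change ⁅ξ, η⁆ = ⁅ξ, η⁆ + coadD 0 η - coadD 0 ξ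
        have h : ∀ ζ : LieDual K g, coadD 0 ζ = 0 := fun ζ => by
          apply LieDual.ext; intro z; simp
        simp [h] }

end Double

/-! ### The function algebra of a formal group -/

section FormalGroup

variable (K a : Type*) [Field K] [LieRing a] [LieAlgebra K a]

/-- The universal enveloping algebra `U(a)`. -/
abbrev U : Type _ := UniversalEnvelopingAlgebra K a

attribute [local instance] LieRing.ofAssociativeRing

variable {K a} in
theorem U.hom_ext {A : Type*} [Ring A] [Algebra K A] {f h : U K a →ₐ[K] A}
    (H : ∀ x, f (UniversalEnvelopingAlgebra.ι K x) = h (UniversalEnvelopingAlgebra.ι K x)) :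
    f = h :=
  UniversalEnvelopingAlgebra.hom_ext K (LieHom.ext H)

/-- The coproduct of `U(a)`, with `x ↦ x ⊗ 1 + 1 ⊗ x` for `x ∈ a`. -/
def U.comul : U K a →ₐ[K] U K a ⊗[K] U K a :=
  UniversalEnvelopingAlgebra.lift K
    { toFun := fun x => UniversalEnvelopingAlgebra.ι K x ⊗ₜ[K] (1 : U K a) +
        (1 : U K a) ⊗ₜ[K] UniversalEnvelopingAlgebra.ι K x
      map_add' := fun x y => by
        simp only [map_add, TensorProduct.add_tmul, TensorProduct.tmul_add]; abel
      map_smul' := fun c x => by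
        simp only [map_smul, TensorProduct.smul_tmul', TensorProduct.tmul_smul, smul_add,
          RingHom.id_apply]
      map_lie' := fun {x y} => by
        simp only [LieHom.map_lie, LieRing.of_associative_ring_bracket, mul_add, add_mul,
          Algebra.TensorProduct.tmul_mul_tmul, mul_one, one_mul, TensorProduct.sub_tmul,
          TensorProduct.tmul_sub]
        abel }

/-- The counit of `U(a)`, with `x ↦ 0` for `x ∈ a`. -/
def U.counit : U K a →ₐ[K] K := UniversalEnvelopingAlgebra.lift K 0

variable {K a} in
@[simp] theorem U.comul_ι (x : a) : U.comul K a (UniversalEnvelopingAlgebra.ι K x) =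
    UniversalEnvelopingAlgebra.ι K x ⊗ₜ[K] (1 : U K a) +
        (1 : U K a) ⊗ₜ[K] UniversalEnvelopingAlgebra.ι K x :=
  UniversalEnvelopingAlgebra.lift_ι_apply K _ x

variable {K a} in
@[simp] theorem U.counit_ι (x : a) : U.counit K a (UniversalEnvelopingAlgebra.ι K x) = 0 :=
  UniversalEnvelopingAlgebra.lift_ι_apply K _ x

instance : Bialgebra K (U K a) :=
  Bialgebra.ofAlgHom (U.comul K a) (U.counit K a)
    (U.hom_ext fun x => by
      simp only [AlgHom.comp_apply, U.comul_ι, map_add, Algebra.TensorProduct.map_tmul, map_one,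
        AlgHom.id_apply, TensorProduct.add_tmul, TensorProduct.tmul_add,
        Algebra.TensorProduct.one_def]
      simp [add_assoc, -UniversalEnvelopingAlgebra.ι_apply])
    (U.hom_ext fun x => by simp [-UniversalEnvelopingAlgebra.ι_apply])
    (U.hom_ext fun x => by simp [-UniversalEnvelopingAlgebra.ι_apply])

theorem U.comul_eq (X : U K a) : Coalgebra.comul (R := K) X = U.comul K a X := rfl

instance : Coalgebra.IsCocomm K (U K a) where
  comm_comp_comul := by
    have : (Algebra.TensorProduct.comm K (U K a) (U K a)).toAlgHom.comp (U.comul K a) =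
        U.comul K a := U.hom_ext fun x => by simp [add_comm, -UniversalEnvelopingAlgebra.ι_apply]
    exact congrArg AlgHom.toLinearMap this

/-- The antipode of `U(a)`, as an algebra morphism to the opposite algebra; `x ↦ -x` for
`x ∈ a`. -/
def U.antipode : U K a →ₐ[K] (U K a)ᵐᵒᵖ :=
  UniversalEnvelopingAlgebra.lift K
    { toFun := fun x => -MulOpposite.op (UniversalEnvelopingAlgebra.ι K x)
      map_add' := fun x y => by simp only [map_add, MulOpposite.op_add]; abel
      map_smul' := fun c x => by simp
      map_lie' := fun {x y} => by
        simp only [LieHom.map_lie, LieRing.of_associative_ring_bracket, MulOpposite.op_sub,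
          MulOpposite.op_mul, neg_mul_neg, neg_sub] }

/-- The function algebra `K[[A]] = U(a)^*` of the formal group `A` with Lie algebra `a`: the full
linear dual of `U(a)`, with the (commutative) product dual to the coproduct of `U(a)`. -/
abbrev FormalFun : Type _ := WithConv (U K a →ₗ[K] K)

variable {K a}

theorem FormalFun.mul_apply (f h : FormalFun K a) (X : U K a) :
    (f * h).ofConv X = LinearMap.mul' K K (TensorProduct.map f.ofConv h.ofConv (U.comul K a X)) :=
  rfl

/-- The infinitesimal right translation `(R_x f)(y) = d/dε f(y e^{εx})`: in terms of functionals
on `U(a)`, `(R_x f)(X) = f(X x)`. -/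
def rightTrans (x : a) : Derivation K (FormalFun K a) (FormalFun K a) :=
  Derivation.mk'
    { toFun := fun f => WithConv.toConv
        (f.ofConv ∘ₗ LinearMap.mulRight K (UniversalEnvelopingAlgebra.ι K x))
      map_add' := fun f h => rfl
      map_smul' := fun c f => rfl }
    (fun f h => by
      have key : ∀ t : U K a ⊗[K] U K a,
          LinearMap.mul' K K (TensorProduct.map f.ofConv h.ofConv
            (t * U.comul K a (UniversalEnvelopingAlgebra.ι K x))) =
          LinearMap.mul' K K (TensorProduct.map f.ofConv
            (h.ofConv ∘ₗ LinearMap.mulRight K (UniversalEnvelopingAlgebra.ι K x)) t) +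
          LinearMap.mul' K K (TensorProduct.map
            (f.ofConv ∘ₗ LinearMap.mulRight K (UniversalEnvelopingAlgebra.ι K x)) h.ofConv t) := by
        intro t
        induction t with
        | zero => simp
        | tmul y z =>
          simp only [U.comul_ι, mul_add, Algebra.TensorProduct.tmul_mul_tmul, mul_one, map_add,
            TensorProduct.map_tmul, LinearMap.mul'_apply, LinearMap.comp_apply,
            LinearMap.mulRight_apply]
          ring
        | add s t hs ht => rw [add_mul, map_add, map_add, hs, ht]; simp only [map_add]; ring
      have h2 := fun X => key (U.comul K a X)
      simp only [← map_mul] at h2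
      rw [smul_eq_mul, smul_eq_mul, mul_comm h]
      exact WithConv.ofConv_injective (LinearMap.ext h2))

/-- The infinitesimal left translation `(L_x f)(y) = d/dε f(e^{-εx} y)`: in terms of functionals
on `U(a)`, `(L_x f)(X) = -f(x X)`. -/
def leftTrans (x : a) : Derivation K (FormalFun K a) (FormalFun K a) :=
  Derivation.mk'
    { toFun := fun f => WithConv.toConv
        (-(f.ofConv ∘ₗ LinearMap.mulLeft K (UniversalEnvelopingAlgebra.ι K x)))
      map_add' := fun f h => by ext X; simp; ring
      map_smul' := fun c f => by ext X; simp }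
    (fun f h => by
      have key : ∀ t : U K a ⊗[K] U K a,
          -LinearMap.mul' K K (TensorProduct.map f.ofConv h.ofConv
            (U.comul K a (UniversalEnvelopingAlgebra.ι K x) * t)) =
          LinearMap.mul' K K (TensorProduct.map f.ofConv
            (-(h.ofConv ∘ₗ LinearMap.mulLeft K (UniversalEnvelopingAlgebra.ι K x))) t) +
          LinearMap.mul' K K (TensorProduct.map
            (-(f.ofConv ∘ₗ LinearMap.mulLeft K (UniversalEnvelopingAlgebra.ι K x)))
            h.ofConv t) := by
        intro t
        induction t with
        | zero => simp
        | tmul y z =>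
          simp only [U.comul_ι, add_mul, Algebra.TensorProduct.tmul_mul_tmul, one_mul, map_add,
            TensorProduct.map_tmul, LinearMap.mul'_apply, LinearMap.comp_apply,
            LinearMap.mulLeft_apply, LinearMap.neg_apply]
          ring
        | add s t hs ht => rw [mul_add, map_add, map_add, neg_add, hs, ht]; simp only [map_add]; ring
      have h2 := fun X => key (U.comul K a X)
      simp only [← map_mul] at h2
      rw [smul_eq_mul, smul_eq_mul, mul_comm h]
      exact WithConv.ofConv_injective (LinearMap.ext h2))

/-- For a Lie algebra morphism `φ : a → b`, the adjoint action `Ad(x⁻¹)` on `b` of the generic point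
`x` of the formal group of `a`: an `End(b)`-valued functional on `U(a)`, `X ↦ ad(S(X))` where `S` is
the antipode. -/
def adInv {b : Type*} [LieRing b] [LieAlgebra K b] (φ : a →ₗ⁅K⁆ b) : U K a →ₗ[K] Module.End K b :=
  (UniversalEnvelopingAlgebra.lift K ((LieAlgebra.ad K b).comp φ)).toLinearMap ∘ₗ
    (MulOpposite.opLinearEquiv K).symm.toLinearMap ∘ₗ (U.antipode K a).toLinearMap

end FormalGroup

/-! ### Extension of derivations to localizations -/

section Localization

variable {K O : Type*} [Field K] [CommRing O] [Algebra K O]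

/-- The algebra morphism `f ↦ f + ε D(f)` from `O` to the dual numbers over `O[1/P]`. -/
def derDual (D : Derivation K O O) (P : O) :
    O →+* TrivSqZeroExt (Localization.Away P) (Localization.Away P) where
  toFun f := TrivSqZeroExt.inl (algebraMap O _ f) + TrivSqZeroExt.inr (algebraMap O _ (D f))
  map_one' := by ext <;> simp
  map_zero' := by ext <;> simp
  map_add' f h := by ext <;> simp [Algebra.smul_def]
  map_mul' f h := by
    ext
    · simp
    · simp only [Derivation.leibniz, smul_eq_mul, map_add, map_mul, TrivSqZeroExt.snd_add,
        TrivSqZeroExt.snd_inl, TrivSqZeroExt.snd_inr, TrivSqZeroExt.snd_mul,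
        TrivSqZeroExt.fst_add, TrivSqZeroExt.fst_inl, TrivSqZeroExt.fst_inr, zero_add, add_zero,
        op_smul_eq_smul]

/-- The extension of `derDual` to `O[1/P]`. -/
def derDualLoc (D : Derivation K O O) (P : O) :
    Localization.Away P →+* TrivSqZeroExt (Localization.Away P) (Localization.Away P) :=
  IsLocalization.Away.lift P (g := derDual D P)
    (TrivSqZeroExt.isUnit_iff_isUnit_fst.2 (by
      simpa [derDual] using IsLocalization.Away.algebraMap_isUnit (S := Localization.Away P) P))

theorem derDualLoc_algebraMap (D : Derivation K O O) (P f : O) :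
    derDualLoc D P (algebraMap O _ f) = derDual D P f :=
  IsLocalization.Away.lift_eq P _ f

theorem fst_derDualLoc (D : Derivation K O O) (P : O) (f : Localization.Away P) :
    (derDualLoc D P f).fst = f := by
  have : ((TrivSqZeroExt.fstHom (Localization.Away P) (Localization.Away P)
      (Localization.Away P)).toRingHom.comp (derDualLoc D P)) = RingHom.id _ := by
    apply IsLocalization.ringHom_ext (Submonoid.powers P)
    ext f
    simp [derDualLoc_algebraMap, derDual]
  exact congrArg (fun φ : Localization.Away P →+* Localization.Away P => φ f) this

/-- The extension of a derivation of `O` to the localization `O[1/P]`. It is the unique derivation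
which agrees with `D` on `O`. -/
def extendDer (D : Derivation K O O) (P : O) :
    Derivation K (Localization.Away P) (Localization.Away P) :=
  Derivation.mk'
    { toFun := fun f => (derDualLoc D P f).snd
      map_add' := fun f h => by simp
      map_smul' := fun c f => by
        have hc : derDualLoc D P (algebraMap K _ c) =
            TrivSqZeroExt.inl (algebraMap K _ c) := by
          rw [IsScalarTower.algebraMap_apply K O (Localization.Away P), derDualLoc_algebraMap]
          ext <;> simp [derDual]
        rw [Algebra.smul_def, map_mul, hc]
        simp [Algebra.smul_def] }
    (fun f h => by simp [fst_derDualLoc, mul_comm])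

theorem extendDer_algebraMap (D : Derivation K O O) (P f : O) :
    extendDer D P (algebraMap O _ f) = algebraMap O _ (D f) := by
  change (derDualLoc D P (algebraMap O _ f)).snd = _
  rw [derDualLoc_algebraMap]
  simp only [derDual, RingHom.coe_mk, MonoidHom.coe_mk, OneHom.coe_mk, TrivSqZeroExt.snd_add,
    TrivSqZeroExt.snd_inl, TrivSqZeroExt.snd_inr, zero_add]

end Localization

open LieBialgebra LieDual

/-! ### Lie subbialgebras -/

section Sub

/-- A Lie subbialgebra of `g`: a Lie subalgebra `h` with `δ(h) ⊆ h ⊗ h`. -/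
structure LieSubbialgebra (K g : Type*) [Field K] [LieRing g] [LieAlgebra K g] [LieBialgebra K g]
    extends LieSubalgebra K g where
  cobracket_mem' : ∀ x ∈ carrier, LieBialgebra.cobracket (K := K) x ∈
    LinearMap.range (TensorProduct.mapIncl toLieSubalgebra.toSubmodule toLieSubalgebra.toSubmodule)

variable {K g : Type*} [Field K] [LieRing g] [LieAlgebra K g] [LieBialgebra K g]
  (h : LieSubbialgebra K g)

/-- The inclusion `h ⊗ h → g ⊗ g`. -/
def LieSubbialgebra.incl2 :
    h.toLieSubalgebra ⊗[K] h.toLieSubalgebra →ₗ[K] g ⊗[K] g :=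
  TensorProduct.map h.toLieSubalgebra.toSubmodule.subtype h.toLieSubalgebra.toSubmodule.subtype

theorem LieSubbialgebra.incl2_injective : Function.Injective h.incl2 :=
  TensorProduct.map_injective_of_flat_flat _ _
    (Submodule.subtype_injective _) (Submodule.subtype_injective _)

/-- The cobracket of `g`, restricted to a map `h → h ⊗ h`. -/
def LieSubbialgebra.cobr :
    h.toLieSubalgebra →ₗ[K] h.toLieSubalgebra ⊗[K] h.toLieSubalgebra :=
  (LinearEquiv.ofInjective h.incl2 h.incl2_injective).symm.toLinearMap ∘ₗ
    LinearMap.codRestrict (LinearMap.range h.incl2)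
      (cobracket (K := K) ∘ₗ h.toLieSubalgebra.toSubmodule.subtype)
      (fun x => h.cobracket_mem' x.1 x.2)

theorem LieSubbialgebra.incl2_cobr (x : h.toLieSubalgebra) :
    h.incl2 (h.cobr x) = cobracket (K := K) (x : g) := by
  have := LinearEquiv.apply_symm_apply (LinearEquiv.ofInjective h.incl2 h.incl2_injective)
    (LinearMap.codRestrict (LinearMap.range h.incl2)
      (cobracket (K := K) ∘ₗ h.toLieSubalgebra.toSubmodule.subtype)
      (fun x => h.cobracket_mem' x.1 x.2) x)
  exact congrArg Subtype.val this

/-- The inclusion `h ⊗ h ⊗ h → g ⊗ g ⊗ g`. -/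
def LieSubbialgebra.incl3 :
    h.toLieSubalgebra ⊗[K] (h.toLieSubalgebra ⊗[K] h.toLieSubalgebra) →ₗ[K]
      g ⊗[K] (g ⊗[K] g) :=
  TensorProduct.map h.toLieSubalgebra.toSubmodule.subtype h.incl2

theorem LieSubbialgebra.incl3_injective : Function.Injective h.incl3 :=
  TensorProduct.map_injective_of_flat_flat _ _ (Submodule.subtype_injective _) h.incl2_injective

theorem LieSubbialgebra.incl2_comm (t : h.toLieSubalgebra ⊗[K] h.toLieSubalgebra) :
    h.incl2 (TensorProduct.comm K _ _ t) = TensorProduct.comm K _ _ (h.incl2 t) := by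
  induction t with
  | zero => simp
  | tmul a b => rfl
  | add s t hs ht => simp only [map_add, hs, ht]

theorem LieSubbialgebra.incl3_cyc
    (t : h.toLieSubalgebra ⊗[K] (h.toLieSubalgebra ⊗[K] h.toLieSubalgebra)) :
    h.incl3 (cyc K _ t) = cyc K _ (h.incl3 t) := by
  induction t with
  | zero => simp
  | tmul a s =>
    induction s with
    | zero => simp
    | tmul b c => rfl
    | add s t hs ht => simp only [TensorProduct.tmul_add, map_add, hs, ht]
  | add s t hs ht => simp only [map_add, hs, ht]

theorem LieSubbialgebra.incl3_assoc (s : h.toLieSubalgebra ⊗[K] h.toLieSubalgebra)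
    (b : h.toLieSubalgebra) :
    h.incl3 (TensorProduct.assoc K _ _ _ (s ⊗ₜ b)) =
      TensorProduct.assoc K g g g (h.incl2 s ⊗ₜ (b : g)) := by
  induction s with
  | zero => simp
  | tmul a c => rfl
  | add s t hs ht => simp only [TensorProduct.add_tmul, map_add, hs, ht]

theorem LieSubbialgebra.incl3_tensorId (t : h.toLieSubalgebra ⊗[K] h.toLieSubalgebra) :
    h.incl3 (tensorId h.cobr t) = tensorId (cobracket (K := K)) (h.incl2 t) := by
  induction t with
  | zero => simp
  | tmul a b =>
    change h.incl3 (TensorProduct.assoc K _ _ _ (h.cobr a ⊗ₜ b)) = _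
    rw [h.incl3_assoc, h.incl2_cobr]
    rfl
  | add s t hs ht => simp only [map_add, hs, ht]

theorem LieSubbialgebra.incl2_lie (x : h.toLieSubalgebra)
    (t : h.toLieSubalgebra ⊗[K] h.toLieSubalgebra) :
    h.incl2 ⁅x, t⁆ = ⁅(x : g), h.incl2 t⁆ := by
  induction t with
  | zero => simp
  | tmul a b =>
    rw [TensorProduct.LieModule.lie_tmul_right]
    change _ = ⁅(x : g), (a : g) ⊗ₜ[K] (b : g)⁆
    rw [TensorProduct.LieModule.lie_tmul_right, map_add]
    rfl
  | add s t hs ht => simp only [map_add, lie_add, hs, ht]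

/-- A Lie subbialgebra is a Lie bialgebra for the restricted cobracket. -/
instance : LieBialgebra K h.toLieSubalgebra where
  cobracket := h.cobr
  antisymm x := by
    rw [mem_wedge2]
    apply h.incl2_injective
    rw [h.incl2_comm, h.incl2_cobr, comm_cobracket, map_neg, h.incl2_cobr]
  coJacobi x := by
    apply h.incl3_injective
    have := coJacobi (K := K) (x : g)
    simp only [alt, LinearMap.add_apply, LinearMap.comp_apply, LinearMap.id_apply] at this ⊢
    simp only [map_add, h.incl3_cyc, h.incl3_tensorId, h.incl2_cobr, map_zero, this]
  cocycle x y := by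
    apply h.incl2_injective
    rw [map_sub, h.incl2_lie, h.incl2_lie, h.incl2_cobr, h.incl2_cobr, h.incl2_cobr]
    exact cocycle (x : g) (y : g)

end Sub

/-! ### Dressing action -/

section Dressing

variable (K h : Type*) [Field K] [CharZero K] [LieRing h] [LieAlgebra K h] [LieBialgebra K h]
  [FiniteDimensional K h]

/-- A basis `(e_i)` of `h`. -/
abbrev stdBasis : Module.Basis (Fin (Module.finrank K h)) K h := Module.finBasis K h

/-- The basis `(ε^i)` of `h^*` dual to `(e_i)`. -/
def dualVec (i : Fin (Module.finrank K h)) : LieDual K h := toDual.symm ((stdBasis K h).coord i)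

variable {K h}

/-- The left dressing action of `a ∈ h` on the function algebra of the formal group `H^*`,
`(dress^L_a f)(x) = -(R_{(Ad(x⁻¹)(a))_{h^*}} f)(x)`. Here `Ad` is the adjoint action of `H^*` on the
double `h ⊕ h^*`, and the component of `Ad(x⁻¹)(a)` in `h^*` is expanded as
`∑ i, ⟨Ad(x⁻¹)(a), e_i⟩ ε^i`. -/
def dressL (a : h) :
    Derivation K (FormalFun K (LieDual K h)) (FormalFun K (LieDual K h)) :=
  -∑ i, (WithConv.toConv
      (LinearMap.applyₗ (stdBasis K h i) ∘ₗ (toDual (K := K) (g := h)).toLinearMap ∘ₗ Double.snd ∘ₗ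
        LinearMap.applyₗ (Double.inl a) ∘ₗ adInv (Double.inr (K := K) (g := h))) :
      FormalFun K (LieDual K h)) • rightTrans (dualVec K h i)

end Dressing

/-! ### Poisson-Lie dynamical r-matrices -/

section RMatrix

variable (K g A : Type*) [Field K] [LieRing g] [LieAlgebra K g] [CommRing A] [Algebra K A]

/-- `(a ⊗ b, a' ⊗ b') ↦ [a, a'] ⊗ b ⊗ b'`. -/
def br12_13 : g ⊗[K] g →ₗ[K] g ⊗[K] g →ₗ[K] g ⊗[K] (g ⊗[K] g) :=
  TensorProduct.map₂ (LieModule.toEnd K g g : g →ₗ[K] Module.End K g) (TensorProduct.mk K g g)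

/-- `(a ⊗ b, a' ⊗ b') ↦ a ⊗ [b, a'] ⊗ b'`. -/
def br12_23 : g ⊗[K] g →ₗ[K] g ⊗[K] g →ₗ[K] g ⊗[K] (g ⊗[K] g) :=
  ((br12_13 K g).comp (TensorProduct.comm K g g).toLinearMap).compr₂
    (TensorProduct.leftComm K g g g).toLinearMap

/-- `(a ⊗ b, a' ⊗ b') ↦ a ⊗ a' ⊗ [b, b']`. -/
def br13_23 : g ⊗[K] g →ₗ[K] g ⊗[K] g →ₗ[K] g ⊗[K] (g ⊗[K] g) :=
  ((br12_13 K g).compl₁₂ (TensorProduct.comm K g g).toLinearMap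
    (TensorProduct.comm K g g).toLinearMap).compr₂ (cyc K g)

theorem br12_13_tmul (a b a' b' : g) :
    br12_13 K g (a ⊗ₜ b) (a' ⊗ₜ b') = ⁅a, a'⁆ ⊗ₜ (b ⊗ₜ b') := rfl

theorem br12_23_tmul (a b a' b' : g) :
    br12_23 K g (a ⊗ₜ b) (a' ⊗ₜ b') = a ⊗ₜ (⁅b, a'⁆ ⊗ₜ b') := rfl

theorem br13_23_tmul (a b a' b' : g) :
    br13_23 K g (a ⊗ₜ b) (a' ⊗ₜ b') = a ⊗ₜ (a' ⊗ₜ ⁅b, b'⁆) := rfl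

variable {K g A}

/-- `CYB(ρ) = [ρ^{1,2}, ρ^{1,3}] + [ρ^{1,2}, ρ^{2,3}] + [ρ^{1,3}, ρ^{2,3}]` for `ρ` with coefficients
in the commutative algebra `A`. -/
def CYB (ρ : (g ⊗[K] g) ⊗[K] A) : (g ⊗[K] (g ⊗[K] g)) ⊗[K] A :=
  TensorProduct.map₂ (br12_13 K g + br12_23 K g + br13_23 K g) (LinearMap.mul K A) ρ ρ

variable [CharZero K] [LieBialgebra K g] [FiniteDimensional K g] (h : LieSubbialgebra K g)

/-- The function algebra `K[[H^*]]` of the formal group of the Lie algebra `h^*` dual to a Lie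
subbialgebra `h`. -/
abbrev DualFun : Type _ := FormalFun K (LieDual K h.toLieSubalgebra)

variable {h} (P : DualFun h)

/-- `d^L(a ⊗ b ⊗ ℓ) = -∑ i, a ⊗ b ⊗ e_i ⊗ L_{ε^i}(ℓ)`, where `(e_i)` and `(ε^i)` are dual bases of `h`
and `h^*`. -/
def dL : (g ⊗[K] g) ⊗[K] Localization.Away P →ₗ[K]
    (g ⊗[K] (g ⊗[K] g)) ⊗[K] Localization.Away P :=
  -∑ i, TensorProduct.map
    ((TensorProduct.assoc K g g g).toLinearMap ∘ₗ
      (TensorProduct.mk K (g ⊗[K] g) g).flip (stdBasis K h.toLieSubalgebra i : g))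
    (extendDer (leftTrans (dualVec K h.toLieSubalgebra i)) P :
      Localization.Away P →ₗ[K] Localization.Away P)

variable (h)

/-- `ρ` is a Poisson-Lie dynamical r-matrix for `(H^*, g, Z)` with coefficients in `K[[H^*]][1/P]`.
(`Z` is meant to be a `g`-invariant antisymmetric tensor with `Alt((δ ⊗ id ⊗ id)(Z)) = 0`, such as
`Z = 0`.) -/
structure IsPLDynamicalRMatrix (Z : g ⊗[K] (g ⊗[K] g)) (P : DualFun h)
    (ρ : (g ⊗[K] g) ⊗[K] Localization.Away P) : Prop where
  ne_zero : P ≠ 0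
  /-- `ρ ∈ ∧²(g) ⊗ K[[H^*]][1/P]` -/
  mem_wedge2 : ρ ∈ LinearMap.range
    (LinearMap.rTensor (Localization.Away P) (wedge2 K g).subtype)
  /-- `dress^L_a(ρ) + [a ⊗ 1 + 1 ⊗ a, ρ] = 0` for `a ∈ h` -/
  equivariant : ∀ a : h.toLieSubalgebra,
    LinearMap.lTensor (g ⊗[K] g) (extendDer (dressL a) P :
        Localization.Away P →ₗ[K] Localization.Away P) ρ +
      LinearMap.rTensor (Localization.Away P) (LieModule.toEnd K g (g ⊗[K] g) (a : g)) ρ = 0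
  /-- `CYB(ρ) + Alt(d^L ρ) + Alt((δ ⊗ id)(ρ)) = Z` -/
  cdybe : CYB ρ + LinearMap.rTensor (Localization.Away P) (alt K g) (dL P ρ) +
    LinearMap.rTensor (Localization.Away P) (alt K g ∘ₗ tensorId (cobracket (K := K))) ρ = Z ⊗ₜ 1

end RMatrix

/-! ### Lie bialgebras with a splitting -/

section Splitting

variable {K g : Type*} [Field K] [LieRing g] [LieAlgebra K g] [LieBialgebra K g]

/-- `(g, δ, l, u)` is a Lie bialgebra with a splitting: `g = l ⊕ u`, `[l, u] ⊆ u` and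
`δ(u) ⊆ (l ⊗ u) ⊕ (u ⊗ l) ⊕ (u ⊗ u)`. -/
structure IsSplitting (l : LieSubbialgebra K g) (u : Submodule K g) : Prop where
  isCompl : IsCompl l.toLieSubalgebra.toSubmodule u
  lie_mem : ∀ x ∈ l.toLieSubalgebra, ∀ y ∈ u, ⁅x, y⁆ ∈ u
  cobracket_mem : ∀ y ∈ u, cobracket (K := K) y ∈
    LinearMap.range (TensorProduct.mapIncl l.toLieSubalgebra.toSubmodule u) ⊔
    LinearMap.range (TensorProduct.mapIncl u l.toLieSubalgebra.toSubmodule) ⊔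
    LinearMap.range (TensorProduct.mapIncl u u)

namespace IsSplitting

variable {l : LieSubbialgebra K g} {u : Submodule K g} (s : IsSplitting l u)

/-- The projection `g → l` parallel to `u`. -/
def projL : g →ₗ[K] l.toLieSubalgebra :=
  Submodule.projectionOnto l.toLieSubalgebra.toSubmodule u s.isCompl

theorem projL_of_mem_u {y : g} (hy : y ∈ u) : s.projL y = 0 :=
  (Submodule.projectionOnto_apply_eq_zero_iff s.isCompl).2 hy

theorem projL_coe (x : l.toLieSubalgebra) : s.projL (x : g) = x :=
  Submodule.projectionOnto_apply_left s.isCompl x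

/-- The pairing `ω₀(λ) : (u, v) ↦ λ([u, v]_l)` on `u`, for `λ ∈ l^*`. -/
def omega0 (lam : Module.Dual K l.toLieSubalgebra) : LinearMap.BilinForm K u :=
  ((LieModule.toEnd K g g : g →ₗ[K] Module.End K g).compl₁₂ u.subtype u.subtype).compr₂
    (lam ∘ₗ s.projL)

/-- Nondegeneracy of the splitting: `ω₀(λ)` is nondegenerate for generic `λ`. As the condition
`det ω₀(λ) ≠ 0` is Zariski open in `λ`, this means that some `ω₀(λ)` is nondegenerate. -/
def Nondegenerate : Prop := ∃ lam, (s.omega0 lam).Nondegenerate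

/-- The extension by zero on `u` of the functional `λ ∈ l^*`. -/
def extendDual : LieDual K l.toLieSubalgebra →ₗ[K] LieDual K g :=
  (toDual (K := K) (g := g)).symm.toLinearMap ∘ₗ LinearMap.lcomp K K s.projL ∘ₗ
    (toDual (K := K) (g := l.toLieSubalgebra)).toLinearMap

theorem extendDual_apply (lam : LieDual K l.toLieSubalgebra) (x : g) :
    toDual (s.extendDual lam) x = toDual lam (s.projL x) := rfl

theorem ev2_extendDual (lam mu : LieDual K l.toLieSubalgebra) (t : g ⊗[K] g) :
    ev2 (s.extendDual lam) (s.extendDual mu) t =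
      ev2 lam mu (TensorProduct.map s.projL s.projL t) := by
  induction t with
  | zero => simp
  | tmul a b => rfl
  | add x y hx hy => simp only [map_add, hx, hy]

theorem map_projL_incl2 (t : l.toLieSubalgebra ⊗[K] l.toLieSubalgebra) :
    TensorProduct.map s.projL s.projL (l.incl2 t) = t := by
  induction t with
  | zero => simp
  | tmul a b =>
    change s.projL (a : g) ⊗ₜ[K] s.projL (b : g) = _
    rw [projL_coe, projL_coe]
  | add x y hx hy => simp only [map_add, hx, hy]

theorem map_projL_cobracket_of_mem {y : g} (hy : y ∈ u) :
    TensorProduct.map s.projL s.projL (cobracket (K := K) y) = 0 := by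
  have h0 : s.projL ∘ₗ u.subtype = 0 := LinearMap.ext fun z => s.projL_of_mem_u z.2
  have hle : LinearMap.range (TensorProduct.mapIncl l.toLieSubalgebra.toSubmodule u) ⊔
      LinearMap.range (TensorProduct.mapIncl u l.toLieSubalgebra.toSubmodule) ⊔
      LinearMap.range (TensorProduct.mapIncl u u) ≤
      LinearMap.ker (TensorProduct.map s.projL s.projL) := by
    refine sup_le (sup_le ?_ ?_) ?_ <;>
    · rw [LinearMap.range_le_ker_iff, TensorProduct.mapIncl, ← TensorProduct.map_comp, h0]
      simp
  exact hle (s.cobracket_mem y hy)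

variable [CharZero K]

/-- The inclusion of Lie algebras `l^* → g^*` defined by the splitting (extension of functionals by
zero on `u`). -/
def dualIncl : LieDual K l.toLieSubalgebra →ₗ⁅K⁆ LieDual K g :=
  { s.extendDual with
    map_lie' := by
      intro lam mu
      apply LieDual.ext
      intro x
      change toDual (s.extendDual ⁅lam, mu⁆) x = toDual ⁅s.extendDual lam, s.extendDual mu⁆ x
      rw [extendDual_apply, LieDual.lie_apply, LieDual.lie_apply, ev2_extendDual]
      congr 1
      have hx : x ∈ l.toLieSubalgebra.toSubmodule ⊔ u := by
        rw [s.isCompl.sup_eq_top]; trivial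
      obtain ⟨y, hy, z, hz, rfl⟩ := Submodule.mem_sup.1 hx
      rw [map_add, map_add, map_add, map_add, s.map_projL_cobracket_of_mem hz,
        s.projL_of_mem_u hz, map_zero, add_zero, add_zero]
      have h1 := s.projL_coe ⟨y, hy⟩
      have h2 := l.incl2_cobr ⟨y, hy⟩
      change s.projL y = _ at h1
      change _ = cobracket (K := K) y at h2
      rw [h1, ← h2, map_projL_incl2]
      rfl }

/-- `Ad(x⁻¹)` on `d(g)`, for `x` the generic point of the formal group `L^* ⊆ G^*`. -/
def adInvL : U K (LieDual K l.toLieSubalgebra) →ₗ[K] Module.End K (Double K g) :=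
  adInv ((Double.inr (K := K) (g := g)).comp s.dualIncl)

/-- The pairing `⟨x, ξ⟩` of `x ∈ g` and `ξ ∈ g^*`. -/
def pair : g ⊗[K] LieDual K g →ₗ[K] K :=
  TensorProduct.lift (toDual (K := K) (g := g)).toLinearMap.flip

/-- The function `x ↦ ⟨(Ad(x⁻¹)(v))_g, (Ad(x⁻¹)(w))_{g^*}⟩` on `L^*`, for `v, w ∈ d(g)`. The product
of the matrix coefficients of `Ad(x⁻¹)` is taken in `K[[L^*]]`, that is, as a functional on
`U(l^*)` it is the composite with the coproduct. -/
def omegaDouble (v w : Double K g) : DualFun l :=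
  WithConv.toConv (pair ∘ₗ
    TensorProduct.map (Double.fst ∘ₗ LinearMap.applyₗ v ∘ₗ s.adInvL)
      (Double.snd ∘ₗ LinearMap.applyₗ w ∘ₗ s.adInvL) ∘ₗ Coalgebra.comul)

/-- The `K[[L^*]]`-valued bilinear form
`ω_x(v, w) = ⟨(Ad(x⁻¹)(v))_g, (Ad(x⁻¹)(w))_{g^*}⟩` on `u`. -/
def omega : u →ₗ[K] u →ₗ[K] DualFun l :=
  LinearMap.mk₂ K (fun v w => s.omegaDouble (Double.inl (v : g)) (Double.inl (w : g)))
    (fun v v' w => by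
      simp only [omegaDouble, Submodule.coe_add, map_add, LinearMap.add_comp, LinearMap.comp_add,
        TensorProduct.map_add_left]
      rfl)
    (fun c v w => by
      simp only [omegaDouble, Submodule.coe_smul, map_smul, LinearMap.smul_comp,
        LinearMap.comp_smul, TensorProduct.map_smul_left]
      rfl)
    (fun v w w' => by
      simp only [omegaDouble, Submodule.coe_add, map_add, LinearMap.add_comp, LinearMap.comp_add,
        TensorProduct.map_add_right]
      rfl)
    (fun c v w => by
      simp only [omegaDouble, Submodule.coe_smul, map_smul, LinearMap.smul_comp,
        LinearMap.comp_smul, TensorProduct.map_smul_right]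
      rfl)

/-- The determinant `P_l^g ∈ K[[L^*]]` of `ω_x`, with respect to a basis of `u` (it is well defined up
to a nonzero scalar). -/
def detOmega {ι : Type*} [Fintype ι] [DecidableEq ι] (b : Module.Basis ι K u) : DualFun l :=
  Matrix.det (Matrix.of fun i j => s.omega (b i) (b j))

/-- For `v ∈ u`, the map `a ⊗ b ⊗ ℓ ↦ a ⊗ ω_x(v, b) ℓ`. -/
def contract (P : DualFun l) (v : u) :
    (u ⊗[K] u) ⊗[K] Localization.Away P →ₗ[K] u ⊗[K] Localization.Away P :=
  LinearMap.lTensor u (TensorProduct.lift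
      ((LinearMap.mul K (Localization.Away P)).comp
        ((Algebra.linearMap (DualFun l) (Localization.Away P)).restrictScalars K ∘ₗ s.omega v))) ∘ₗ
    (TensorProduct.assoc K u u (Localization.Away P)).toLinearMap

/-- `σ = (ω_x)⁻¹`: writing `σ = ∑ a_α ⊗ b_α ⊗ ℓ_α`, one has `∑ a_α ⊗ ω_x(v, b_α) ℓ_α = v ⊗ 1` for any
`v ∈ u`. -/
def IsInverse (P : DualFun l) (σ : (u ⊗[K] u) ⊗[K] Localization.Away P) : Prop :=
  ∀ v : u, s.contract P v σ = v ⊗ₜ 1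

end IsSplitting

end Splitting

end PLDyn

end

/-! Conceptually, `Ad(x)` for `x` in `L^*` preserves the canonical form of the double, its bracket
and the subalgebra `g^*`. So `Ad(x)(g)` is a Lagrangian Lie subalgebra complementary to `g^*`, that
is, the graph of `y ↦ ω_x(y, ·)`. Being Lagrangian says that `ω` is antisymmetric (`omegaG_swap`);
being a subalgebra is the Maurer-Cartan type identity `omegaCyc_eq_zero`, and its inverse form is
the dynamical Yang-Baxter equation.

On the formal group such identities follow from uniqueness for a linear differential system:
functions that vanish at the unit and whose left derivatives are combinations of functions of the
same family are zero (`FormalFun.eq_zero_of_leftTrans_mem`). The system for `ω` is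
`leftTrans_omegaG`: `ξ ∈ l^*` acts through the coadjoint operator `coadL ξ` on both arguments, plus
the constant `ξ([y, x])`. This method gives antisymmetry, the orthogonality of `u` and `l`, the
identity `omegaCyc_eq_zero` and the derivative along dressing fields, `dressD_omegaG`.

The form vanishes at the unit and its differential there in the direction `λ` is the pairing of the
splitting. Along the curve `e^{tλ}` the matrix of `ω` is thus `t` times a matrix with invertible
constant term for a suitable `λ`, so `P ≠ 0` (`det_ne_zero_of_differential`).

After inverting `P`, linear algebra gives a unique inverse `σ`, antisymmetric because `ω` is.
Equations for `σ` are tested on the functionals `ω(v, ·)`, `v ∈ u`, together with `l^*`; these span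
all functionals over the localization (`span_testFunctionals`). The contractions of `σ` with them
are the constants `v` and `0`, so derivatives of `σ` become derivatives of `ω`. Equivariance reduces
to `dressD_omegaG`. In the Yang-Baxter equation, three functionals from `u` give `omegaCyc_eq_zero`,
two from `u` and one from `l^*` give `leftTrans_omegaG`, and in the other cases every term vanishes.
-/

noncomputable section

namespace PLDyn

open LieBialgebra LieDual

/-! ### Functions on a formal group -/

section FormalGroupCalculus

attribute [local instance] LieRing.ofAssociativeRing

variable {K a : Type*} [Field K] [LieRing a] [LieAlgebra K a]

local notation "ιU" => UniversalEnvelopingAlgebra.ι K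

/-- A subspace of `U(a)` that contains `1` and is stable under left multiplication by `a` is
everything. -/
theorem U.mem_of_mulLeft_mem (S : Submodule K (U K a)) (h1 : (1 : U K a) ∈ S)
    (hS : ∀ (x : a), ∀ X ∈ S, ιU x * X ∈ S) (X : U K a) : X ∈ S := by
  -- The elements whose left multiplication preserves `S` form a subalgebra containing `a`. By the
  -- universal property the identity of `U(a)` factors through it, so it is everything; applying its
  -- elements to `1 ∈ S` concludes.
  let B : Subalgebra K (U K a) :=
    { carrier := {Y | ∀ X ∈ S, Y * X ∈ S}
      mul_mem' := fun {Y Z} hY hZ X hX => by rw [mul_assoc]; exact hY _ (hZ _ hX)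
      add_mem' := fun {Y Z} hY hZ X hX => by rw [add_mul]; exact S.add_mem (hY _ hX) (hZ _ hX)
      algebraMap_mem' := fun c X hX => by
        rw [← Algebra.smul_def]; exact S.smul_mem _ hX }
  have hι : ∀ x : a, ιU x ∈ B := hS
  let j : a →ₗ⁅K⁆ B :=
    { toFun := fun x => ⟨ιU x, hι x⟩
      map_add' := fun x y => Subtype.ext (map_add _ x y)
      map_smul' := fun c x => Subtype.ext (map_smul _ c x)
      map_lie' := fun {x y} => Subtype.ext (LieHom.map_lie _ x y) }
  have key : B.val.comp (UniversalEnvelopingAlgebra.lift K j) = AlgHom.id K (U K a) :=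
    U.hom_ext fun x => by
      rw [AlgHom.comp_apply, UniversalEnvelopingAlgebra.lift_ι_apply]; rfl
  have hX : X ∈ B := by
    have := congrArg (fun φ : U K a →ₐ[K] U K a => φ X) key
    simp only [AlgHom.comp_apply, AlgHom.id_apply] at this
    rw [← this]
    exact (UniversalEnvelopingAlgebra.lift K j X).2
  simpa using hX 1 h1

theorem leftTrans_apply (x : a) (f : FormalFun K a) (X : U K a) :
    (leftTrans (K := K) x f).ofConv X = -f.ofConv (ιU x * X) := rfl

theorem rightTrans_apply (x : a) (f : FormalFun K a) (X : U K a) :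
    (rightTrans (K := K) x f).ofConv X = f.ofConv (X * ιU x) := rfl

/-- Evaluation at the unit of the formal group. -/
theorem FormalFun.mul_apply_one (f h : FormalFun K a) :
    (f * h).ofConv 1 = f.ofConv 1 * h.ofConv 1 := by
  rw [FormalFun.mul_apply, map_one, Algebra.TensorProduct.one_def]
  simp

theorem FormalFun.algebraMap_apply_one (c : K) :
    (algebraMap K (FormalFun K a) c).ofConv 1 = c := by
  rw [Algebra.algebraMap_eq_smul_one, WithConv.ofConv_smul, LinearMap.smul_apply]
  change c • (algebraMap K K (U.counit K a 1)) = c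
  simp

/-- A set of functions that is stable, up to linear combinations, under infinitesimal left
translations and whose elements vanish at the unit consists of `0` only. -/
theorem FormalFun.eq_zero_of_leftTrans_mem (S : Set (FormalFun K a))
    (h1 : ∀ f ∈ S, f.ofConv 1 = 0)
    (hS : ∀ (x : a), ∀ f ∈ S, leftTrans (K := K) x f ∈ Submodule.span K S) {f : FormalFun K a}
    (hf : f ∈ S) : f = 0 := by
  have h1' : ∀ f ∈ Submodule.span K S, f.ofConv 1 = 0 := by
    intro f hf
    induction hf using Submodule.span_induction with
    | mem f hf => exact h1 f hf
    | zero => rfl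
    | add f h _ _ hf hh => rw [WithConv.ofConv_add, LinearMap.add_apply, hf, hh, add_zero]
    | smul c f _ hf => rw [WithConv.ofConv_smul, LinearMap.smul_apply, hf, smul_zero]
  have hS' : ∀ (x : a), ∀ f ∈ Submodule.span K S, leftTrans (K := K) x f ∈ Submodule.span K S := by
    intro x f hf
    induction hf using Submodule.span_induction with
    | mem f hf => exact hS x f hf
    | zero => rw [map_zero]; exact Submodule.zero_mem _
    | add f h _ _ hf hh => rw [map_add]; exact Submodule.add_mem _ hf hh
    | smul c f _ hf => rw [Derivation.map_smul]; exact Submodule.smul_mem _ _ hf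
  -- The common zeros in `U(a)` of the span of `S`. Stability under left multiplication by `a` holds
  -- because `f(xX) = -(L_x f)(X)`.
  let T : Submodule K (U K a) :=
    { carrier := {X | ∀ f ∈ Submodule.span K S, f.ofConv X = 0}
      zero_mem' := fun f _ => map_zero _
      add_mem' := fun {X Y} hX hY f hf => by rw [map_add, hX f hf, hY f hf, add_zero]
      smul_mem' := fun c X hX f hf => by rw [map_smul, hX f hf, smul_zero] }
  have hT : ∀ X, X ∈ T := U.mem_of_mulLeft_mem T h1' fun x X hX f hf => by
    have := hX _ (hS' x f hf)
    rwa [leftTrans_apply, neg_eq_zero] at this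
  exact WithConv.ofConv_injective (LinearMap.ext fun X => hT X f (Submodule.subset_span hf))

theorem leftTrans_rightTrans_comm (x y : a) (f : FormalFun K a) :
    leftTrans (K := K) x (rightTrans (K := K) y f) = rightTrans (K := K) y (leftTrans (K := K) x f) :=
  WithConv.ofConv_injective (LinearMap.ext fun X => by
    simp only [leftTrans_apply, rightTrans_apply, mul_assoc])

theorem leftTrans_lie (x y : a) (f : FormalFun K a) :
    leftTrans (K := K) x (leftTrans (K := K) y f) - leftTrans (K := K) y (leftTrans (K := K) x f) = leftTrans (K := K) ⁅x, y⁆ f :=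
  WithConv.ofConv_injective (LinearMap.ext fun X => by
    rw [WithConv.ofConv_sub, LinearMap.sub_apply]
    simp only [leftTrans_apply, LieHom.map_lie, LieRing.of_associative_ring_bracket, sub_mul,
      map_sub, mul_assoc]
    ring)

theorem leftTrans_sum_smul {ι : Type*} [Fintype ι] (c : ι → K) (x : ι → a) (f : FormalFun K a) :
    leftTrans (K := K) (∑ i, c i • x i) f = ∑ i, c i • leftTrans (K := K) (x i) f :=
  WithConv.ofConv_injective (LinearMap.ext fun X => by
    simp [leftTrans_apply, Finset.sum_mul, -UniversalEnvelopingAlgebra.ι_apply])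

theorem leftTrans_algebraMap (x : a) (c : K) :
    leftTrans (K := K) x (algebraMap K (FormalFun K a) c) = 0 :=
  Derivation.map_algebraMap _ _

/-! ### The adjoint action -/

section Ad

variable {b : Type*} [LieRing b] [LieAlgebra K b] (φ : a →ₗ⁅K⁆ b)

theorem adInv_one : adInv φ 1 = 1 := by
  simp [adInv]

/-- The antipode reverses products and changes the sign of `x`. This sign cancels the one in
`leftTrans`, so that left translation by `x` turns `Ad(·⁻¹)(v)` into `Ad(·⁻¹)([x, v])`. -/
theorem adInv_ι_mul (x : a) (X : U K a) (v : b) :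
    adInv φ (ιU x * X) v = -adInv φ X ⁅φ x, v⁆ := by
  have hx : U.antipode K a (ιU x) = -MulOpposite.op (ιU x) :=
    UniversalEnvelopingAlgebra.lift_ι_apply K _ x
  simp only [adInv, LinearMap.comp_apply, AlgHom.toLinearMap_apply, map_mul, hx,
    LinearEquiv.coe_coe, MulOpposite.coe_opLinearEquiv_symm, MulOpposite.unop_mul,
    MulOpposite.unop_neg, MulOpposite.unop_op, map_neg, UniversalEnvelopingAlgebra.lift_ι_apply,
    Module.End.mul_apply, LinearMap.neg_apply, LieHom.comp_apply, LieAlgebra.ad_apply]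

end Ad

/-! ### Formal one-parameter subgroups -/

/-- Binomial formula for the commuting elements `x ⊗ 1` and `1 ⊗ x`; it makes restriction to
`e^{tx}` multiplicative. -/
theorem U.comul_pow (x : a) (n : ℕ) : U.comul K a (ιU x ^ n) =
    ∑ m ∈ Finset.HasAntidiagonal.antidiagonal n, (n.choose m.1 : K) • ((ιU x ^ m.1) ⊗ₜ[K] (ιU x ^ m.2)) := by
  rw [map_pow, U.comul_ι, Commute.add_pow']
  · refine Finset.sum_congr rfl fun m _ => ?_
    rw [Algebra.TensorProduct.tmul_pow, Algebra.TensorProduct.tmul_pow,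
      Algebra.TensorProduct.tmul_mul_tmul, one_pow, one_pow, one_mul, mul_one, Nat.cast_smul_eq_nsmul]
  · simp [commute_iff_eq, -UniversalEnvelopingAlgebra.ι_apply]

variable [CharZero K]

/-- Restriction of a function to the formal one-parameter subgroup `t ↦ e^{tx}`. -/
def expRestrict (x : a) : FormalFun K a →+* PowerSeries K where
  -- The expansion of `f(e^{tx})` with `e^{tx} = ∑ t^n x^n / n!`; characteristic `0` is what permits
  -- the division.
  toFun f := PowerSeries.mk fun n => f.ofConv (ιU x ^ n) / (n.factorial : K)
  map_one' := by
    ext n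
    rw [PowerSeries.coeff_mk, PowerSeries.coeff_one]
    change algebraMap K K (U.counit K a (ιU x ^ n)) / _ = _
    rw [map_pow, U.counit_ι]
    split_ifs with h
    · simp [h]
    · simp [zero_pow h]
  map_zero' := by
    ext n
    rw [PowerSeries.coeff_mk]
    exact zero_div _
  map_add' f h := by
    ext n
    rw [map_add]
    simp only [PowerSeries.coeff_mk, WithConv.ofConv_add, LinearMap.add_apply, add_div]
  map_mul' f h := by
    ext n
    rw [PowerSeries.coeff_mul]
    simp only [PowerSeries.coeff_mk]
    rw [FormalFun.mul_apply, U.comul_pow, map_sum, map_sum, Finset.sum_div]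
    refine Finset.sum_congr rfl fun m hm => ?_
    rw [Finset.HasAntidiagonal.mem_antidiagonal] at hm
    subst hm
    have h1 : ((m.1.factorial : K)) ≠ 0 := Nat.cast_ne_zero.2 (Nat.factorial_ne_zero _)
    have h2 : ((m.2.factorial : K)) ≠ 0 := Nat.cast_ne_zero.2 (Nat.factorial_ne_zero _)
    have h3 : (((m.1 + m.2).factorial : K)) ≠ 0 := Nat.cast_ne_zero.2 (Nat.factorial_ne_zero _)
    have h4 : ((m.1 + m.2).choose m.1 : K) * m.1.factorial * m.2.factorial =
        (m.1 + m.2).factorial := by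
      rw [Nat.choose_symm_add]
      exact_mod_cast Nat.add_choose_mul_factorial_mul_factorial m.1 m.2
    simp only [map_smul, TensorProduct.map_tmul, LinearMap.mul'_apply, smul_eq_mul]
    field_simp
    linear_combination (f.ofConv (ιU x ^ m.1) * h.ofConv (ιU x ^ m.2)) * h4

theorem coeff_expRestrict (x : a) (f : FormalFun K a) (n : ℕ) :
    PowerSeries.coeff n (expRestrict x f) = f.ofConv (ιU x ^ n) / (n.factorial : K) :=
  PowerSeries.coeff_mk n fun n => f.ofConv (ιU x ^ n) / (n.factorial : K)

/-- A matrix of functions that vanish at the unit has nonzero determinant if its differential at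
the unit has nonzero determinant in some direction. -/
theorem det_ne_zero_of_differential {ι : Type*} [Fintype ι] [DecidableEq ι]
    (M : Matrix ι ι (FormalFun K a)) (h0 : ∀ i j, (M i j).ofConv 1 = 0) (x : a)
    (hx : (Matrix.of fun i j => (M i j).ofConv (ιU x)).det ≠ 0) : M.det ≠ 0 := by
  intro hM
  have hdvd : ∀ i j, ∃ p, expRestrict x (M i j) = PowerSeries.X * p := fun i j => by
    have : PowerSeries.X ∣ expRestrict x (M i j) := by
      rw [PowerSeries.X_dvd_iff, ← PowerSeries.coeff_zero_eq_constantCoeff_apply, coeff_expRestrict]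
      simp [h0]
    exact this
  choose p hp using hdvd
  -- The factor `t` comes out of the determinant as a power of `t`, which is not a zero divisor, so
  -- `det p = 0`. Its constant term is the determinant of the differential.
  have h1 : (expRestrict x).mapMatrix M = (PowerSeries.X : PowerSeries K) • Matrix.of p := by
    ext1 i j
    simp [hp]
  have h2 : (Matrix.of p).det = 0 := by
    have := congrArg (expRestrict x) hM
    rw [RingHom.map_det, h1, Matrix.det_smul, map_zero] at this
    exact (mul_eq_zero.1 this).resolve_left (pow_ne_zero _ PowerSeries.X_ne_zero)
  apply hx
  have h3 := congrArg (PowerSeries.constantCoeff (R := K)) h2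
  rw [RingHom.map_det, map_zero] at h3
  rw [← h3]
  congr 1
  ext i j
  have h4 := congrArg (PowerSeries.coeff 1) (hp i j)
  rw [coeff_expRestrict, show (1 : ℕ) = 0 + 1 from rfl, PowerSeries.coeff_succ_X_mul] at h4
  simpa using h4

end FormalGroupCalculus

end PLDyn

namespace PLDyn

open LieBialgebra LieDual

/-! ### The function `ω` on the formal group `L^*` -/

namespace IsSplitting

attribute [local instance] LieRing.ofAssociativeRing

variable {K g : Type*} [Field K] [CharZero K] [LieRing g] [LieAlgebra K g] [LieBialgebra K g]
  {l : LieSubbialgebra K g} {u : Submodule K g} (s : IsSplitting l u)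

theorem adInvL_one : s.adInvL 1 = 1 := adInv_one _

theorem adInvL_ι_mul (ξ : LieDual K l.toLieSubalgebra) (X : U K (LieDual K l.toLieSubalgebra))
    (v : Double K g) : s.adInvL (UniversalEnvelopingAlgebra.ι K ξ * X) v =
      -s.adInvL X ⁅Double.inr (s.extendDual ξ), v⁆ :=
  adInv_ι_mul _ ξ X v

/-- `omegaDouble` as a bilinear map. -/
def omegaD : Double K g →ₗ[K] Double K g →ₗ[K] DualFun l :=
  LinearMap.mk₂ K (fun v w => s.omegaDouble v w)
    (fun v v' w => by
      simp only [omegaDouble, map_add, LinearMap.add_comp, LinearMap.comp_add,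
        TensorProduct.map_add_left]
      rfl)
    (fun c v w => by
      simp only [omegaDouble, map_smul, LinearMap.smul_comp,
        LinearMap.comp_smul, TensorProduct.map_smul_left]
      rfl)
    (fun v w w' => by
      simp only [omegaDouble, map_add, LinearMap.add_comp, LinearMap.comp_add,
        TensorProduct.map_add_right]
      rfl)
    (fun c v w => by
      simp only [omegaDouble, map_smul, LinearMap.smul_comp,
        LinearMap.comp_smul, TensorProduct.map_smul_right]
      rfl)

theorem omegaD_apply (v w : Double K g) : s.omegaD v w = s.omegaDouble v w := rfl

/-- Since `ξ` is primitive for the coproduct, left translation obeys the Leibniz rule in the two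
matrix coefficients of `Ad(x⁻¹)`. -/
theorem leftTrans_omegaD (ξ : LieDual K l.toLieSubalgebra) (v w : Double K g) :
    leftTrans (K := K) ξ (s.omegaD v w) = s.omegaD ⁅Double.inr (s.extendDual ξ), v⁆ w +
      s.omegaD v ⁅Double.inr (s.extendDual ξ), w⁆ := by
  let α : Double K g → U K (LieDual K l.toLieSubalgebra) →ₗ[K] g :=
    fun v => Double.fst ∘ₗ LinearMap.applyₗ v ∘ₗ s.adInvL
  let β : Double K g → U K (LieDual K l.toLieSubalgebra) →ₗ[K] LieDual K g :=
    fun v => Double.snd ∘ₗ LinearMap.applyₗ v ∘ₗ s.adInvL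
  let x := UniversalEnvelopingAlgebra.ι K ξ
  have hα : ∀ v X, α v (x * X) = -α ⁅Double.inr (s.extendDual ξ), v⁆ X := fun v X => by
    change Double.fst (s.adInvL (x * X) v) = -Double.fst (s.adInvL X _)
    rw [adInvL_ι_mul, map_neg]
  have hβ : ∀ v X, β v (x * X) = -β ⁅Double.inr (s.extendDual ξ), v⁆ X := fun v X => by
    change Double.snd (s.adInvL (x * X) v) = -Double.snd (s.adInvL X _)
    rw [adInvL_ι_mul, map_neg]
  have key : ∀ t : U K (LieDual K l.toLieSubalgebra) ⊗[K] U K (LieDual K l.toLieSubalgebra),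
      -pair (TensorProduct.map (α v) (β w) (U.comul K _ x * t)) =
      pair (TensorProduct.map (α ⁅Double.inr (s.extendDual ξ), v⁆) (β w) t) +
      pair (TensorProduct.map (α v) (β ⁅Double.inr (s.extendDual ξ), w⁆) t) := by
    intro t
    induction t with
    | zero => simp
    | tmul y z =>
      simp only [x, U.comul_ι, add_mul, Algebra.TensorProduct.tmul_mul_tmul, one_mul, map_add,
        TensorProduct.map_tmul]
      rw [hα, hβ]
      simp only [TensorProduct.neg_tmul, TensorProduct.tmul_neg, map_neg]
      ring
    | add s t hs ht => rw [mul_add, map_add, map_add, neg_add, hs, ht]; simp only [map_add]; ring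
  refine WithConv.ofConv_injective (LinearMap.ext fun X => ?_)
  have h := key (U.comul K _ X)
  rw [← map_mul] at h
  exact h

/-- `g^*` is a Lie subalgebra of the double containing `l^*`, hence stable under `Ad(L^*)`. -/
theorem fst_adInvL_inr (X : U K (LieDual K l.toLieSubalgebra)) (η : LieDual K g) :
    Double.fst (s.adInvL X (Double.inr η)) = 0 := by
  let S : Submodule K (U K (LieDual K l.toLieSubalgebra)) :=
    { carrier := {X | ∀ η : LieDual K g, Double.fst (s.adInvL X (Double.inr η)) = 0}
      zero_mem' := fun η => by simp
      add_mem' := fun {X Y} hX hY η => by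
        rw [map_add, LinearMap.add_apply, map_add, hX, hY, add_zero]
      smul_mem' := fun c X hX η => by
        rw [map_smul, LinearMap.smul_apply, map_smul, hX, smul_zero] }
  refine U.mem_of_mulLeft_mem S (fun η => ?_) (fun ξ X hX η => ?_) X η
  · rw [adInvL_one]; rfl
  · rw [adInvL_ι_mul, ← LieHom.map_lie, map_neg, hX, neg_zero]

theorem omegaD_inr_left (η : LieDual K g) (w : Double K g) : s.omegaD (Double.inr η) w = 0 := by
  have h : Double.fst ∘ₗ LinearMap.applyₗ (Double.inr η) ∘ₗ s.adInvL = 0 :=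
    LinearMap.ext fun X => s.fst_adInvL_inr X η
  rw [omegaD_apply, omegaDouble, h, TensorProduct.map_zero_left, LinearMap.zero_comp,
    LinearMap.comp_zero]
  rfl

theorem omegaD_apply_one (v w : Double K g) :
    (s.omegaD v w).ofConv 1 = toDual (Double.snd w) (Double.fst v) := by
  change pair (TensorProduct.map _ _ (U.comul K _ 1)) = _
  rw [map_one, Algebra.TensorProduct.one_def, TensorProduct.map_tmul]
  simp only [LinearMap.comp_apply, LinearMap.applyₗ_apply_apply, adInvL_one, Module.End.one_apply]
  rfl

theorem fst_lie_inr (ξ : LieDual K g) (v : Double K g) :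
    Double.fst ⁅Double.inr ξ, v⁆ = -coadG (Double.fst v) ξ := by
  rw [Double.fst_lie]
  change ⁅(0 : g), _⁆ + coadG 0 _ - coadG _ ξ = _
  simp [coadG]

theorem lie_inr_inl (ξ : LieDual K g) (x : g) :
    ⁅(Double.inr ξ : Double K g), Double.inl x⁆ =
      Double.inl (-coadG x ξ) + Double.inr (-coadD x ξ) := by
  apply Double.ext
  · rw [fst_lie_inr, map_add]
    change -coadG x ξ = -coadG x ξ + 0
    rw [add_zero]
  · rw [Double.snd_lie, map_add]
    change ⁅ξ, 0⁆ + coadD 0 0 - coadD x ξ = 0 + -coadD x ξ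
    have : coadD (0 : g) (0 : LieDual K g) = 0 := by apply LieDual.ext; intro z; simp
    rw [lie_zero, this]
    abel

theorem toDual_coadG (x : g) (ξ η : LieDual K g) : toDual η (coadG x ξ) = toDual ⁅ξ, η⁆ x :=
  toDual_ev1 ξ η _

/-- `Ad(x⁻¹)(η)` stays in `g^*`, so this pairing is the whole canonical form of the double, which is
invariant and hence constant in `x`. -/
theorem omegaD_inr_right (v : Double K g) (η : LieDual K g) :
    s.omegaD v (Double.inr η) = algebraMap K _ (toDual η (Double.fst v)) := by
  rw [← sub_eq_zero]
  refine FormalFun.eq_zero_of_leftTrans_mem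
    {f | ∃ v η, f = s.omegaD v (Double.inr η) - algebraMap K _ (toDual η (Double.fst v))}
    ?_ ?_ ⟨v, η, rfl⟩
  · rintro f ⟨v, η, rfl⟩
    rw [WithConv.ofConv_sub, LinearMap.sub_apply, omegaD_apply_one,
      FormalFun.algebraMap_apply_one]
    exact sub_self _
  · rintro ξ f ⟨v, η, rfl⟩
    -- The two added constants cancel each other: this is the infinitesimal invariance of the
    -- canonical form.
    have h : leftTrans (K := K) ξ (s.omegaD v (Double.inr η) - algebraMap K _ (toDual η (Double.fst v))) =
        (s.omegaD ⁅Double.inr (s.extendDual ξ), v⁆ (Double.inr η) - algebraMap K _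
          (toDual η (Double.fst ⁅Double.inr (s.extendDual ξ), v⁆))) +
        (s.omegaD v (Double.inr ⁅s.extendDual ξ, η⁆) - algebraMap K _
          (toDual ⁅s.extendDual ξ, η⁆ (Double.fst v))) := by
      rw [map_sub, leftTrans_algebraMap, leftTrans_omegaD, fst_lie_inr, map_neg, toDual_coadG,
        LieHom.map_lie, map_neg]
      abel
    rw [h]
    exact Submodule.add_mem _ (Submodule.subset_span ⟨_, _, rfl⟩) (Submodule.subset_span ⟨_, _, rfl⟩)

/-- The form `ω` on all of `g`. -/
def omegaG : g →ₗ[K] g →ₗ[K] DualFun l := s.omegaD.compl₁₂ Double.inl Double.inl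

theorem omegaG_apply (x y : g) : s.omegaG x y = s.omegaD (Double.inl x) (Double.inl y) := rfl

theorem omegaG_apply_one (x y : g) : (s.omegaG x y).ofConv 1 = 0 := by
  rw [omegaG_apply, omegaD_apply_one]
  rfl

/-- The coadjoint action `x ↦ (ξ ⊗ id)(δ(x))` of `ξ ∈ l^*` on `g`. -/
def coadL (ξ : LieDual K l.toLieSubalgebra) : g →ₗ[K] g :=
  ev1 (s.extendDual ξ) ∘ₗ cobracket

theorem coadL_apply (ξ : LieDual K l.toLieSubalgebra) (x : g) :
    s.coadL ξ x = coadG x (s.extendDual ξ) := rfl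

/-- The differential system that governs `ω`. The `g^*`-part of `[ξ, x]` contributes nothing in the
first argument, and that of `[ξ, y]` contributes a constant in the second. -/
theorem leftTrans_omegaG (ξ : LieDual K l.toLieSubalgebra) (x y : g) :
    leftTrans (K := K) ξ (s.omegaG x y) = -s.omegaG (s.coadL ξ x) y - s.omegaG x (s.coadL ξ y) +
      algebraMap K _ (toDual (s.extendDual ξ) ⁅y, x⁆) := by
  rw [omegaG_apply, leftTrans_omegaD, lie_inr_inl, lie_inr_inl]
  simp only [map_add, LinearMap.add_apply, omegaD_inr_left, omegaD_inr_right, map_neg,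
    LinearMap.neg_apply, omegaG_apply, coadL_apply, neg_zero, add_zero]
  change _ + (_ + -(algebraMap K _ (-toDual (s.extendDual ξ) ⁅y, x⁆))) = _
  rw [map_neg]
  abel

/-- `g` is isotropic in the double, and so is its image under `Ad(x⁻¹)`. In the differential system
the constants cancel by antisymmetry of the bracket. -/
theorem omegaG_swap (x y : g) : s.omegaG x y = -s.omegaG y x := by
  rw [← sub_eq_zero, sub_neg_eq_add]
  refine FormalFun.eq_zero_of_leftTrans_mem {f | ∃ x y, f = s.omegaG x y + s.omegaG y x}
    ?_ ?_ ⟨x, y, rfl⟩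
  · rintro f ⟨x, y, rfl⟩
    rw [WithConv.ofConv_add, LinearMap.add_apply, omegaG_apply_one, omegaG_apply_one, add_zero]
  · rintro ξ f ⟨x, y, rfl⟩
    have h : leftTrans (K := K) ξ (s.omegaG x y + s.omegaG y x) =
        -(s.omegaG (s.coadL ξ x) y + s.omegaG y (s.coadL ξ x)) -
        (s.omegaG x (s.coadL ξ y) + s.omegaG (s.coadL ξ y) x) := by
      rw [map_add, leftTrans_omegaG, leftTrans_omegaG, ← lie_skew x y, map_neg, map_neg]
      abel
    rw [h]
    exact Submodule.sub_mem _ (Submodule.neg_mem _ (Submodule.subset_span ⟨_, _, rfl⟩))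
      (Submodule.subset_span ⟨_, _, rfl⟩)

theorem extendDual_of_mem_u (ξ : LieDual K l.toLieSubalgebra) {v : g} (hv : v ∈ u) :
    toDual (s.extendDual ξ) v = 0 := by
  rw [extendDual_apply, s.projL_of_mem_u hv, map_zero]

theorem extendDual_coe (ξ : LieDual K l.toLieSubalgebra) (a : l.toLieSubalgebra) :
    toDual (s.extendDual ξ) (a : g) = toDual ξ a := by
  rw [extendDual_apply, s.projL_coe]

theorem ev1_mapIncl (ξ : LieDual K g) {p q : Submodule K g} (t : p ⊗[K] q) :
    ev1 ξ (TensorProduct.mapIncl p q t) ∈ q := by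
  induction t with
  | zero => simp
  | tmul a b => exact q.smul_mem _ b.2
  | add x y hx hy => rw [map_add, map_add]; exact q.add_mem hx hy

theorem ev1_mapIncl_of_vanish {ξ : LieDual K g} {p q : Submodule K g}
    (h : ∀ x ∈ p, toDual ξ x = 0) (t : p ⊗[K] q) :
    ev1 ξ (TensorProduct.mapIncl p q t) = 0 := by
  induction t with
  | zero => simp
  | tmul a b =>
    change toDual ξ (a : g) • (b : g) = 0
    rw [h a a.2, zero_smul]
  | add x y hx hy => rw [map_add, map_add, hx, hy, add_zero]

/-- This is where the condition on `δ(u)` enters: the extended functional kills `u`, so a component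
in `u ⊗ l` contributes nothing and the others end in `u`. -/
theorem coadL_mem_u (ξ : LieDual K l.toLieSubalgebra) {v : g} (hv : v ∈ u) :
    s.coadL ξ v ∈ u := by
  have hle : LinearMap.range (TensorProduct.mapIncl l.toLieSubalgebra.toSubmodule u) ⊔
      LinearMap.range (TensorProduct.mapIncl u l.toLieSubalgebra.toSubmodule) ⊔
      LinearMap.range (TensorProduct.mapIncl u u) ≤ u.comap (ev1 (s.extendDual ξ)) := by
    refine sup_le (sup_le ?_ ?_) ?_
    · rintro _ ⟨t, rfl⟩; exact ev1_mapIncl _ t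
    · rintro _ ⟨t, rfl⟩
      rw [Submodule.mem_comap, ev1_mapIncl_of_vanish fun x hx => s.extendDual_of_mem_u ξ hx]
      exact u.zero_mem
    · rintro _ ⟨t, rfl⟩; exact ev1_mapIncl _ t
  exact hle (s.cobracket_mem v hv)

/-- The coadjoint actions of `ξ ∈ l^*` on `l` and on `g` agree on `l`. -/
theorem coe_coadG (ξ : LieDual K l.toLieSubalgebra) (a : l.toLieSubalgebra) :
    ((coadG a ξ : l.toLieSubalgebra) : g) = s.coadL ξ (a : g) := by
  have h : ∀ t : l.toLieSubalgebra ⊗[K] l.toLieSubalgebra,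
      ((ev1 ξ t : l.toLieSubalgebra) : g) = ev1 (s.extendDual ξ) (l.incl2 t) := by
    intro t
    induction t with
    | zero => simp
    | tmul a b =>
      change ((toDual ξ a • b : l.toLieSubalgebra) : g) =
        toDual (s.extendDual ξ) (a : g) • (b : g)
      rw [s.extendDual_coe]
      rfl
    | add x y hx hy => rw [map_add, map_add, map_add, ← hx, ← hy]; rfl
  rw [coadL_apply, coadG, coadG, ← l.incl2_cobr, ← h]
  rfl

/-- Functionals that vanish on `l` act trivially on `l`. -/
theorem coadG_of_vanish {η : LieDual K g} (hη : ∀ x ∈ l.toLieSubalgebra, toDual η x = 0)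
    (a : l.toLieSubalgebra) : coadG (a : g) η = 0 := by
  obtain ⟨t, ht⟩ := l.cobracket_mem' a.1 a.2
  rw [coadG, ← ht]
  exact ev1_mapIncl_of_vanish hη t

/-- The operators `coadL ξ` preserve `u` and `l`, and the constant in the differential system
vanishes because `[l, u] ⊆ u`. -/
theorem omegaG_u_l {v : g} (hv : v ∈ u) (a : l.toLieSubalgebra) : s.omegaG v (a : g) = 0 := by
  refine FormalFun.eq_zero_of_leftTrans_mem
    {f | ∃ v ∈ u, ∃ a : l.toLieSubalgebra, f = s.omegaG v (a : g)} ?_ ?_ ⟨v, hv, a, rfl⟩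
  · rintro f ⟨v, hv, a, rfl⟩
    exact s.omegaG_apply_one _ _
  · rintro ξ f ⟨v, hv, a, rfl⟩
    rw [leftTrans_omegaG, s.extendDual_of_mem_u ξ (s.lie_mem a.1 a.2 v hv), map_zero, add_zero,
      ← s.coe_coadG]
    exact Submodule.sub_mem _ (Submodule.neg_mem _
      (Submodule.subset_span ⟨_, s.coadL_mem_u ξ hv, _, rfl⟩))
      (Submodule.subset_span ⟨_, hv, _, rfl⟩)

/-- The differential of `ω` at the unit: there only the constant term of the differential system
survives. On `u` it is the pairing `omega0` of the splitting. -/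
theorem omegaG_apply_ι (ξ : LieDual K l.toLieSubalgebra) (x y : g) :
    (s.omegaG x y).ofConv (UniversalEnvelopingAlgebra.ι K ξ) =
      toDual (s.extendDual ξ) ⁅x, y⁆ := by
  have h := congrArg (fun f : DualFun l => f.ofConv 1) (s.leftTrans_omegaG ξ x y)
  simp only [leftTrans_apply, mul_one, WithConv.ofConv_add, WithConv.ofConv_sub,
    WithConv.ofConv_neg, LinearMap.add_apply, LinearMap.sub_apply, LinearMap.neg_apply,
    omegaG_apply_one, FormalFun.algebraMap_apply_one] at h
  rw [← lie_skew x y, map_neg]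
  linear_combination -h

/-- The determinant of `ω` is nonzero for a nondegenerate splitting. -/
theorem detOmega_ne_zero (hs : s.Nondegenerate) {ι : Type*} [Fintype ι] [DecidableEq ι]
    (b : Module.Basis ι K u) : s.detOmega b ≠ 0 := by
  obtain ⟨lam, hlam⟩ := hs
  refine det_ne_zero_of_differential _ (fun i j => s.omegaG_apply_one _ _)
    (toDual.symm lam : LieDual K l.toLieSubalgebra) ?_
  have h := (LinearMap.BilinForm.nondegenerate_iff_det_ne_zero b).1 hlam
  convert h using 2
  ext i j
  rw [LinearMap.BilinForm.toMatrix_apply]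
  exact s.omegaG_apply_ι _ _ _

end IsSplitting

end PLDyn

namespace PLDyn

open LieBialgebra LieDual

/-! ### Evaluation of tensors on functionals with values in a commutative algebra -/

section TensorEval

variable {K V R : Type*} [Field K] [AddCommGroup V] [Module K V] [CommRing R] [Algebra K R]

/-- `a ⊗ b ↦ φ(a) ψ(b)`. -/
def eval2 (φ ψ : V →ₗ[K] R) : V ⊗[K] V →ₗ[K] R :=
  LinearMap.mul' K R ∘ₗ TensorProduct.map φ ψ

/-- `a ⊗ b ⊗ c ↦ φ(a) ψ(b) χ(c)`. -/
def eval3 (φ ψ χ : V →ₗ[K] R) : V ⊗[K] (V ⊗[K] V) →ₗ[K] R :=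
  LinearMap.mul' K R ∘ₗ TensorProduct.map φ (eval2 ψ χ)

@[simp] theorem eval2_tmul (φ ψ : V →ₗ[K] R) (a b : V) :
    eval2 φ ψ (a ⊗ₜ b) = φ a * ψ b := rfl

@[simp] theorem eval3_tmul (φ ψ χ : V →ₗ[K] R) (a b c : V) :
    eval3 φ ψ χ (a ⊗ₜ (b ⊗ₜ c)) = φ a * (ψ b * χ c) := rfl

theorem eval2_add_left (φ φ' ψ : V →ₗ[K] R) (t : V ⊗[K] V) :
    eval2 (φ + φ') ψ t = eval2 φ ψ t + eval2 φ' ψ t := by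
  simp [eval2, TensorProduct.map_add_left]

theorem eval2_add_right (φ ψ ψ' : V →ₗ[K] R) (t : V ⊗[K] V) :
    eval2 φ (ψ + ψ') t = eval2 φ ψ t + eval2 φ ψ' t := by
  simp [eval2, TensorProduct.map_add_right]

theorem eval2_sub_left (φ φ' ψ : V →ₗ[K] R) (t : V ⊗[K] V) :
    eval2 (φ - φ') ψ t = eval2 φ ψ t - eval2 φ' ψ t := by
  rw [eq_sub_iff_add_eq, ← eval2_add_left, sub_add_cancel]

theorem eval2_sub_right (φ ψ ψ' : V →ₗ[K] R) (t : V ⊗[K] V) :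
    eval2 φ (ψ - ψ') t = eval2 φ ψ t - eval2 φ ψ' t := by
  rw [eq_sub_iff_add_eq, ← eval2_add_right, sub_add_cancel]

theorem eval2_neg_left (φ ψ : V →ₗ[K] R) (t : V ⊗[K] V) :
    eval2 (-φ) ψ t = -eval2 φ ψ t := by
  rw [eq_neg_iff_add_eq_zero, ← eval2_add_left, neg_add_cancel]
  simp [eval2]

theorem eval2_neg_right (φ ψ : V →ₗ[K] R) (t : V ⊗[K] V) :
    eval2 φ (-ψ) t = -eval2 φ ψ t := by
  rw [eq_neg_iff_add_eq_zero, ← eval2_add_right, neg_add_cancel]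
  simp [eval2]

theorem eval2_comm (φ ψ : V →ₗ[K] R) (t : V ⊗[K] V) :
    eval2 φ ψ (TensorProduct.comm K V V t) = eval2 ψ φ t := by
  induction t with
  | zero => simp
  | tmul a b => simp [mul_comm]
  | add s t hs ht => simp [hs, ht]

theorem derivation_eval2 (D : Derivation K R R) (φ ψ : V →ₗ[K] R) (t : V ⊗[K] V) :
    D (eval2 φ ψ t) = eval2 (D.toLinearMap ∘ₗ φ) ψ t + eval2 φ (D.toLinearMap ∘ₗ ψ) t := by
  induction t with
  | zero => simp
  | tmul a b =>
    simp only [eval2_tmul, Derivation.leibniz, smul_eq_mul, LinearMap.comp_apply,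
      Derivation.coeFn_coe]
    ring
  | add s t hs ht => simp only [map_add, hs, ht]; ring

end TensorEval

/-! ### Contractions of the cobracket and the co-Jacobi identity -/

section CobracketEval

variable {K g R : Type*} [Field K] [LieRing g] [LieAlgebra K g] [LieBialgebra K g]
  [CommRing R] [Algebra K R]

theorem eval2_swap_cobracket (φ ψ : g →ₗ[K] R) (x : g) :
    eval2 φ ψ (cobracket x) = -eval2 ψ φ (cobracket x) := by
  rw [← eval2_comm, comm_cobracket, map_neg]

/-- An `R`-valued functional obtained from `ξ ∈ g^*` by extension of scalars. -/
def scalarDual (R : Type*) [CommRing R] [Algebra K R] (ξ : LieDual K g) : g →ₗ[K] R :=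
  Algebra.linearMap K R ∘ₗ toDual ξ

@[simp] theorem scalarDual_apply (ξ : LieDual K g) (x : g) :
    scalarDual R ξ x = algebraMap K R (toDual ξ x) := rfl

theorem eval2_scalarDual_left (ξ : LieDual K g) (ψ : g →ₗ[K] R) (t : g ⊗[K] g) :
    eval2 (scalarDual R ξ) ψ t = ψ (ev1 ξ t) := by
  induction t with
  | zero => simp
  | tmul a b => simp [Algebra.smul_def]
  | add s t hs ht => simp only [map_add, hs, ht]

/-- `ξ ∈ g^*` acts by a coderivation of `δ`. -/
theorem coad_coderivation (ξ : LieDual K g) (x : g) :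
    LinearMap.rTensor g (ev1 ξ ∘ₗ cobracket) (cobracket (K := K) x) +
      LinearMap.lTensor g (ev1 ξ ∘ₗ cobracket) (cobracket (K := K) x) =
      cobracket (K := K) (coadG x ξ) := by
  let N : g →ₗ[K] g := ev1 ξ ∘ₗ cobracket
  -- The claim is co-Jacobi with `ξ` inserted in the first slot: the three cyclic terms become the
  -- action on the first factor, the action on the second factor, and minus the cobracket of `coadG
  -- x ξ`.
  let c : g ⊗[K] (g ⊗[K] g) →ₗ[K] g ⊗[K] g :=
    (TensorProduct.lid K (g ⊗[K] g)).toLinearMap ∘ₗ LinearMap.rTensor (g ⊗[K] g) (toDual ξ)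
  have c_tmul : ∀ a b d : g, c (a ⊗ₜ (b ⊗ₜ d)) = toDual ξ a • (b ⊗ₜ[K] d) := fun _ _ _ => rfl
  have h0 : ∀ t : g ⊗[K] g, c (tensorId cobracket t) = LinearMap.rTensor g N t := by
    have key : ∀ (s : g ⊗[K] g) (b : g),
        c (TensorProduct.assoc K g g g (s ⊗ₜ b)) = ev1 ξ s ⊗ₜ b := by
      intro s b
      induction s with
      | zero => simp
      | tmul a d => simp [c_tmul, TensorProduct.smul_tmul']
      | add s t hs ht => rw [TensorProduct.add_tmul]; simp [hs, ht, TensorProduct.add_tmul]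
    intro t
    induction t with
    | zero => simp
    | tmul a b => simp [tensorId, key, N]
    | add s t hs ht => simp only [map_add, hs, ht]
  have h1 : ∀ t : g ⊗[K] g, c (cyc K g (tensorId cobracket t)) =
      -LinearMap.lTensor g N (TensorProduct.comm K g g t) := by
    have key : ∀ (s : g ⊗[K] g) (b : g),
        c (cyc K g (TensorProduct.assoc K g g g (s ⊗ₜ b))) =
          b ⊗ₜ ev1 ξ (TensorProduct.comm K g g s) := by
      intro s b
      induction s with
      | zero => simp
      | tmul a d => simp [c_tmul, cyc_tmul]
      | add s t hs ht => rw [TensorProduct.add_tmul]; simp [hs, ht, TensorProduct.tmul_add]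
    intro t
    induction t with
    | zero => simp
    | tmul a b => simp [tensorId, key, N, comm_cobracket, TensorProduct.tmul_neg]
    | add s t hs ht => simp only [map_add, hs, ht, neg_add]
  have h2 : ∀ t : g ⊗[K] g, c (cyc K g (cyc K g (tensorId cobracket t))) =
      cobracket (ev1 ξ (TensorProduct.comm K g g t)) := by
    have key : ∀ (s : g ⊗[K] g) (b : g),
        c (cyc K g (cyc K g (TensorProduct.assoc K g g g (s ⊗ₜ b)))) = toDual ξ b • s := by
      intro s b
      induction s with
      | zero => simp
      | tmul a d => simp [c_tmul, cyc_tmul]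
      | add s t hs ht => rw [TensorProduct.add_tmul]; simp [hs, ht]
    intro t
    induction t with
    | zero => simp
    | tmul a b => simp [tensorId, key]
    | add s t hs ht => simp only [map_add, hs, ht]
  have h := congrArg c (coJacobi (K := K) x)
  simp only [alt, LinearMap.add_apply, LinearMap.comp_apply, LinearMap.id_apply, map_add,
    map_zero, h0, h1, h2, comm_cobracket, map_neg, neg_neg] at h
  rwa [add_neg_eq_zero] at h

theorem eval2_coad (ξ : LieDual K g) (φ ψ : g →ₗ[K] R) (x : g) :
    eval2 (φ ∘ₗ ev1 ξ ∘ₗ cobracket) ψ (cobracket x) +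
      eval2 φ (ψ ∘ₗ ev1 ξ ∘ₗ cobracket) (cobracket x) =
      eval2 φ ψ (cobracket (coadG x ξ)) := by
  have h : ∀ t : g ⊗[K] g, eval2 (φ ∘ₗ ev1 ξ ∘ₗ cobracket) ψ t +
      eval2 φ (ψ ∘ₗ ev1 ξ ∘ₗ cobracket) t =
      eval2 φ ψ (LinearMap.rTensor g (ev1 ξ ∘ₗ cobracket) t +
        LinearMap.lTensor g (ev1 ξ ∘ₗ cobracket) t) := by
    intro t
    induction t with
    | zero => simp
    | tmul a b => simp
    | add s t hs ht =>
      simp only [map_add] at hs ht ⊢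
      linear_combination hs + ht
  rw [h, coad_coderivation]

end CobracketEval

/-! ### The closedness identity for `ω` -/

namespace IsSplitting

variable {K g : Type*} [Field K] [CharZero K] [LieRing g] [LieAlgebra K g] [LieBialgebra K g]
  {l : LieSubbialgebra K g} {u : Submodule K g} (s : IsSplitting l u)

/-- The differential system read as an identity of functionals in the second argument, ready for
insertion into `eval2`. -/
theorem leftTrans_comp_omegaG (ξ : LieDual K l.toLieSubalgebra) (x : g) :
    (leftTrans (K := K) ξ).toLinearMap ∘ₗ s.omegaG x =
      -s.omegaG (s.coadL ξ x) - s.omegaG x ∘ₗ s.coadL ξ +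
        scalarDual _ (coadD x (s.extendDual ξ)) := by
  refine LinearMap.ext fun y => ?_
  have h := s.leftTrans_omegaG ξ x y
  rw [← lie_skew, map_neg] at h
  exact h

/-- By the cocycle condition, `coadL ξ` is a derivation of the bracket up to two coadjoint
corrections. -/
theorem coadL_lie (ξ : LieDual K l.toLieSubalgebra) (x y : g) :
    s.coadL ξ ⁅x, y⁆ = ⁅x, s.coadL ξ y⁆ + ⁅s.coadL ξ x, y⁆ +
      coadG x (coadD y (s.extendDual ξ)) - coadG y (coadD x (s.extendDual ξ)) := by
  rw [coadL_apply, coadG_lie_left, coadL_apply, coadL_apply, ← lie_skew y]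
  abel

/-- `coadL ξ` is a coderivation, which moves it from the functionals to `z`. The last two terms come
from the constants of the differential system; after cyclic summation they cancel the corrections in
`coadL_lie`. -/
theorem leftTrans_eval2_omegaG (ξ : LieDual K l.toLieSubalgebra) (x y z : g) :
    leftTrans (K := K) ξ (eval2 (s.omegaG x) (s.omegaG y) (cobracket z)) =
      -eval2 (s.omegaG (s.coadL ξ x)) (s.omegaG y) (cobracket z)
      - eval2 (s.omegaG x) (s.omegaG (s.coadL ξ y)) (cobracket z)
      - eval2 (s.omegaG x) (s.omegaG y) (cobracket (s.coadL ξ z))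
      + s.omegaG y (coadG z (coadD x (s.extendDual ξ)))
      - s.omegaG x (coadG z (coadD y (s.extendDual ξ))) := by
  rw [derivation_eval2, leftTrans_comp_omegaG, leftTrans_comp_omegaG]
  simp only [eval2_add_left, eval2_add_right, eval2_sub_left, eval2_sub_right, eval2_neg_left,
    eval2_neg_right]
  rw [eval2_scalarDual_left, eval2_swap_cobracket _ (scalarDual _ _), eval2_scalarDual_left,
    s.coadL_apply ξ z, ← eval2_coad]
  simp only [coadG, coadL]
  abel

/-- The sum that expresses the compatibility of `ω` with the bracket and the cobracket of `g`. -/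
def omegaCyc (x y z : g) : DualFun l :=
  s.omegaG z ⁅x, y⁆ + s.omegaG x ⁅y, z⁆ + s.omegaG y ⁅z, x⁆ +
    eval2 (s.omegaG x) (s.omegaG y) (cobracket z) + eval2 (s.omegaG y) (s.omegaG z) (cobracket x) +
    eval2 (s.omegaG z) (s.omegaG x) (cobracket y)

theorem leftTrans_omegaCyc (ξ : LieDual K l.toLieSubalgebra) (x y z : g) :
    leftTrans (K := K) ξ (s.omegaCyc x y z) = -s.omegaCyc (s.coadL ξ x) y z -
      s.omegaCyc x (s.coadL ξ y) z - s.omegaCyc x y (s.coadL ξ z) := by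
  -- The constants produced by the three bracket terms add up to the Jacobi identity paired with
  -- `ξ`.
  have hJ : algebraMap K (DualFun l) (toDual (s.extendDual ξ) ⁅⁅x, y⁆, z⁆) +
      algebraMap K (DualFun l) (toDual (s.extendDual ξ) ⁅⁅y, z⁆, x⁆) +
      algebraMap K (DualFun l) (toDual (s.extendDual ξ) ⁅⁅z, x⁆, y⁆) = 0 := by
    have h := lie_jacobi x y z
    rw [← lie_skew x ⁅y, z⁆, ← lie_skew y ⁅z, x⁆, ← lie_skew z ⁅x, y⁆] at h
    rw [← map_add, ← map_add, ← map_add, ← map_add]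
    have h' : ⁅⁅x, y⁆, z⁆ + ⁅⁅y, z⁆, x⁆ + ⁅⁅z, x⁆, y⁆ = 0 := by
      rw [← neg_eq_zero, ← h]; abel
    rw [h', map_zero, map_zero]
  simp only [omegaCyc, map_add, leftTrans_omegaG, leftTrans_eval2_omegaG, coadL_lie, map_sub]
  linear_combination hJ

theorem eval2_apply_one (φ ψ : g →ₗ[K] DualFun l) (hφ : ∀ x, (φ x).ofConv 1 = 0) (t : g ⊗[K] g) :
    (eval2 φ ψ t).ofConv 1 = 0 := by
  induction t with
  | zero => simp
  | tmul a b => rw [eval2_tmul, FormalFun.mul_apply_one, hφ, zero_mul]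
  | add s t hs ht => rw [map_add, WithConv.ofConv_add, LinearMap.add_apply, hs, ht, add_zero]

/-- In the double, this is the vanishing of `⟨[x + ω(x,·), y + ω(y,·)], z + ω(z,·)⟩`: the graph of
`ω` is a Lagrangian subalgebra. -/
theorem omegaCyc_eq_zero (x y z : g) : s.omegaCyc x y z = 0 := by
  refine FormalFun.eq_zero_of_leftTrans_mem {f | ∃ x y z, f = s.omegaCyc x y z} ?_ ?_
    ⟨x, y, z, rfl⟩
  · rintro f ⟨x, y, z, rfl⟩
    simp only [omegaCyc, WithConv.ofConv_add, LinearMap.add_apply, omegaG_apply_one,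
      eval2_apply_one _ _ (s.omegaG_apply_one _), add_zero]
  · rintro ξ f ⟨x, y, z, rfl⟩
    rw [leftTrans_omegaCyc]
    exact Submodule.sub_mem _ (Submodule.sub_mem _ (Submodule.neg_mem _
      (Submodule.subset_span ⟨_, _, _, rfl⟩)) (Submodule.subset_span ⟨_, _, _, rfl⟩))
      (Submodule.subset_span ⟨_, _, _, rfl⟩)

end IsSplitting

/-! ### The dressing action -/

section DressingDouble

attribute [local instance] LieRing.ofAssociativeRing

variable {K h : Type*} [Field K] [CharZero K] [LieRing h] [LieAlgebra K h] [LieBialgebra K h]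
  [FiniteDimensional K h]

/-- The function `x ↦ ⟨(Ad(x⁻¹)(y))_{h^*}, e_i⟩` on `H^*`, for `y` in the double. -/
def dressCoeff (i : Fin (Module.finrank K h)) : Double K h →ₗ[K] FormalFun K (LieDual K h) where
  toFun y := WithConv.toConv
    (LinearMap.applyₗ (stdBasis K h i) ∘ₗ (toDual (K := K) (g := h)).toLinearMap ∘ₗ Double.snd ∘ₗ
      LinearMap.applyₗ y ∘ₗ adInv (Double.inr (K := K) (g := h)))
  map_add' y y' := by
    simp only [map_add, LinearMap.add_comp, LinearMap.comp_add]
    rfl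
  map_smul' c y := by
    simp only [map_smul, LinearMap.smul_comp, LinearMap.comp_smul]
    rfl

/-- The derivation `f ↦ (x ↦ (R_{(Ad(x⁻¹)(y))_{h^*}} f)(x))`, for `y` in the double. -/
def dressD (y : Double K h) :
    Derivation K (FormalFun K (LieDual K h)) (FormalFun K (LieDual K h)) :=
  ∑ i, dressCoeff i y • rightTrans (K := K) (dualVec K h i)

theorem dressL_eq (a : h) : dressL a = -dressD (K := K) (Double.inl a) := rfl

theorem dressD_apply (y : Double K h) (f : FormalFun K (LieDual K h)) :
    dressD y f = ∑ i, dressCoeff i y * rightTrans (K := K) (dualVec K h i) f := by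
  change Derivation.coeFnAddMonoidHom (∑ i, dressCoeff i y • rightTrans (K := K) (dualVec K h i)) f
    = _
  rw [map_sum, Finset.sum_apply]
  rfl

theorem dressD_add (y y' : Double K h) (f : FormalFun K (LieDual K h)) :
    dressD (K := K) (y + y') f = dressD y f + dressD y' f := by
  simp only [dressD_apply, map_add, add_mul, Finset.sum_add_distrib]

theorem dressD_neg (y : Double K h) (f : FormalFun K (LieDual K h)) :
    dressD (K := K) (-y) f = -dressD y f := by
  rw [eq_neg_iff_add_eq_zero, ← dressD_add, neg_add_cancel, dressD_apply]
  simp only [map_zero, zero_mul, Finset.sum_const_zero]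

theorem leftTrans_dressCoeff (i : Fin (Module.finrank K h)) (ξ : LieDual K h) (y : Double K h) :
    leftTrans (K := K) ξ (dressCoeff i y) = dressCoeff i ⁅Double.inr ξ, y⁆ :=
  WithConv.ofConv_injective (LinearMap.ext fun X => by
    rw [leftTrans_apply]
    change -toDual (Double.snd (adInv Double.inr (UniversalEnvelopingAlgebra.ι K ξ * X) y)) _ =
      toDual (Double.snd (adInv Double.inr X ⁅Double.inr ξ, y⁆)) _
    rw [adInv_ι_mul, map_neg, map_neg, LinearMap.neg_apply, neg_neg])

theorem dressCoeff_apply_one (i : Fin (Module.finrank K h)) (y : Double K h) :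
    (dressCoeff i y).ofConv 1 = toDual (Double.snd y) (stdBasis K h i) := by
  change toDual (Double.snd (adInv Double.inr 1 y)) _ = _
  rw [adInv_one]
  rfl

theorem sum_dualVec (η : LieDual K h) :
    ∑ i, toDual η (stdBasis K h i) • dualVec K h i = η := by
  apply LieDual.ext
  intro x
  conv_rhs => rw [← (stdBasis K h).sum_repr x]
  simp only [map_sum, map_smul, LinearMap.sum_apply, LinearMap.smul_apply, dualVec,
    LinearEquiv.apply_symm_apply, Module.Basis.coord_apply, smul_eq_mul]
  exact Finset.sum_congr rfl fun i _ => mul_comm _ _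

/-- Left and right translations commute, so the commutator with `L_ξ` only affects the coefficients,
where it replaces `y` by `[ξ, y]`. Allowing `y` in the whole double keeps this family closed. -/
theorem leftTrans_dressD (ξ : LieDual K h) (y : Double K h) (f : FormalFun K (LieDual K h)) :
    leftTrans (K := K) ξ (dressD y f) = dressD (K := K) ⁅Double.inr ξ, y⁆ f + dressD y (leftTrans (K := K) ξ f) := by
  simp only [dressD_apply, map_sum, Derivation.leibniz, smul_eq_mul, leftTrans_dressCoeff,
    leftTrans_rightTrans_comm, Finset.sum_add_distrib]
  rw [add_comm]
  simp only [mul_comm]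

/-- Infinitesimal form of `x e^{t Ad(x⁻¹)η} = e^{tη} x`; the sign is that of the convention for
`L_η`. -/
theorem dressD_inr (η : LieDual K h) (f : FormalFun K (LieDual K h)) :
    dressD (K := K) (Double.inr η) f = -leftTrans (K := K) η f := by
  rw [← sub_eq_zero, sub_neg_eq_add]
  -- Both `η` and `f` vary in the family, because the derivative along `ξ` involves `[ξ, η]` and
  -- `L_ξ f`.
  refine FormalFun.eq_zero_of_leftTrans_mem
    {F | ∃ (η : LieDual K h) (f : FormalFun K (LieDual K h)),
      F = dressD (K := K) (Double.inr η) f + leftTrans (K := K) η f} ?_ ?_ ⟨η, f, rfl⟩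
  · rintro F ⟨η, f, rfl⟩
    have h1 : (dressD (K := K) (Double.inr η) f).ofConv 1 =
        ∑ i, toDual η (stdBasis K h i) * f.ofConv (UniversalEnvelopingAlgebra.ι K (dualVec K h i)) := by
      rw [dressD_apply, WithConv.ofConv_sum, LinearMap.sum_apply]
      refine Finset.sum_congr rfl fun i _ => ?_
      rw [FormalFun.mul_apply_one, dressCoeff_apply_one, rightTrans_apply, one_mul]
      rfl
    have h2 : f.ofConv (UniversalEnvelopingAlgebra.ι K η) =
        ∑ i, toDual η (stdBasis K h i) *
          f.ofConv (UniversalEnvelopingAlgebra.ι K (dualVec K h i)) := by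
      conv_lhs => rw [← sum_dualVec η]
      simp only [map_sum, map_smul, smul_eq_mul]
    rw [WithConv.ofConv_add, LinearMap.add_apply, h1, leftTrans_apply, mul_one, h2, add_neg_cancel]
  · rintro ξ F ⟨η, f, rfl⟩
    have h2 : leftTrans (K := K) ξ (dressD (K := K) (Double.inr η) f + leftTrans (K := K) η f) =
        (dressD (K := K) (Double.inr ⁅ξ, η⁆) f + leftTrans (K := K) ⁅ξ, η⁆ f) +
        (dressD (K := K) (Double.inr η) (leftTrans (K := K) ξ f) + leftTrans (K := K) η (leftTrans (K := K) ξ f)) := by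
      rw [map_add, leftTrans_dressD, ← leftTrans_lie, LieHom.map_lie]
      abel
    rw [h2]
    exact Submodule.add_mem _ (Submodule.subset_span ⟨_, _, rfl⟩) (Submodule.subset_span ⟨_, _, rfl⟩)

end DressingDouble

/-! ### Invariance of `ω` under the dressing action -/

namespace IsSplitting

variable {K g : Type*} [Field K] [CharZero K] [LieRing g] [LieAlgebra K g] [LieBialgebra K g]
  [FiniteDimensional K g]
  {l : LieSubbialgebra K g} {u : Submodule K g} (s : IsSplitting l u)

theorem projL_lie (a : l.toLieSubalgebra) (x : g) : s.projL ⁅(a : g), x⁆ = ⁅a, s.projL x⁆ := by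
  have hx : x ∈ l.toLieSubalgebra.toSubmodule ⊔ u := by
    rw [s.isCompl.sup_eq_top]; trivial
  obtain ⟨y, hy, z, hz, rfl⟩ := Submodule.mem_sup.1 hx
  rw [lie_add, map_add, map_add, s.projL_of_mem_u hz,
    s.projL_of_mem_u (s.lie_mem a.1 a.2 z hz), add_zero, add_zero]
  have h1 := s.projL_coe ⟨y, hy⟩
  have h2 := s.projL_coe ⁅a, ⟨y, hy⟩⁆
  change s.projL y = _ at h1
  rw [h1]
  exact h2

theorem extendDual_coadD (a : l.toLieSubalgebra) (ξ : LieDual K l.toLieSubalgebra) :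
    s.extendDual (coadD a ξ) = coadD (a : g) (s.extendDual ξ) := by
  apply LieDual.ext
  intro x
  rw [extendDual_apply, coadD_apply, coadD_apply, extendDual_apply, projL_lie]

/-- The derivative of `ω` along the dressing vector fields. -/
theorem dressD_omegaG (a : l.toLieSubalgebra) {x y : g} (hx : x ∈ u) (hy : y ∈ u) :
    dressD (K := K) (Double.inl a) (s.omegaG x y) = -s.omegaG ⁅(a : g), x⁆ y - s.omegaG x ⁅(a : g), y⁆ := by
  rw [← sub_eq_zero]
  refine FormalFun.eq_zero_of_leftTrans_mem
    {f | ∃ (a : l.toLieSubalgebra), ∃ x ∈ u, ∃ y ∈ u, f = dressD (K := K) (Double.inl a) (s.omegaG x y) -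
      (-s.omegaG ⁅(a : g), x⁆ y - s.omegaG x ⁅(a : g), y⁆)} ?_ ?_ ⟨a, x, hx, y, hy, rfl⟩
  · rintro f ⟨a, x, hx, y, hy, rfl⟩
    -- The dressing field vanishes at the unit, where `Ad(x⁻¹)(a) = a` has no component in `l^*`.
    have h1 : (dressD (K := K) (Double.inl a) (s.omegaG x y)).ofConv 1 = 0 := by
      rw [dressD_apply, WithConv.ofConv_sum, LinearMap.sum_apply]
      refine Finset.sum_eq_zero fun i _ => ?_
      rw [FormalFun.mul_apply_one, dressCoeff_apply_one]
      exact zero_mul _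
    simp only [WithConv.ofConv_sub, WithConv.ofConv_neg, LinearMap.sub_apply, LinearMap.neg_apply,
      omegaG_apply_one, h1, neg_zero, sub_zero]
  · rintro ξ f ⟨a, x, hx, y, hy, rfl⟩
    -- One correction in `coadL_lie` drops out: `coadD v ξ` vanishes on `l` since `[l, u] ⊆ u`, so
    -- it acts trivially on `a` since `δ(l) ⊆ l ⊗ l`.
    have hN : ∀ v ∈ u, s.coadL ξ ⁅(a : g), v⁆ = ⁅(a : g), s.coadL ξ v⁆ +
        ⁅s.coadL ξ (a : g), v⁆ - s.coadL (coadD a ξ) v := by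
      intro v hv
      rw [coadL_lie, coadG_of_vanish (l := l) _ a, add_zero, ← extendDual_coadD]
      · rfl
      · intro z hz
        rw [coadD_apply, ← lie_skew, map_neg, neg_neg]
        exact s.extendDual_of_mem_u ξ (s.lie_mem z hz v hv)
    -- Jacobi balances the constants, including the one produced by the `l^*`-part of `[ξ, a]`,
    -- which acts as a left translation.
    have hc : toDual (s.extendDual ξ) ⁅y, ⁅(a : g), x⁆⁆ + toDual (s.extendDual ξ) ⁅⁅(a : g), y⁆, x⁆ =
        -toDual (s.extendDual (coadD a ξ)) ⁅y, x⁆ := by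
      rw [extendDual_coadD, coadD_apply, neg_neg, leibniz_lie (a : g) y x, map_add, add_comm]
    have hc' := congrArg (algebraMap K (DualFun l)) hc
    rw [map_add, map_neg] at hc'
    have h2 : leftTrans (K := K) ξ (dressD (K := K) (Double.inl a) (s.omegaG x y) -
        (-s.omegaG ⁅(a : g), x⁆ y - s.omegaG x ⁅(a : g), y⁆)) =
        -(dressD (K := K) (Double.inl (coadG a ξ)) (s.omegaG x y) -
          (-s.omegaG ⁅((coadG a ξ : l.toLieSubalgebra) : g), x⁆ y -
            s.omegaG x ⁅((coadG a ξ : l.toLieSubalgebra) : g), y⁆)) -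
        (dressD (K := K) (Double.inl a) (s.omegaG (s.coadL ξ x) y) -
          (-s.omegaG ⁅(a : g), s.coadL ξ x⁆ y - s.omegaG (s.coadL ξ x) ⁅(a : g), y⁆)) -
        (dressD (K := K) (Double.inl a) (s.omegaG x (s.coadL ξ y)) -
          (-s.omegaG ⁅(a : g), x⁆ (s.coadL ξ y) - s.omegaG x ⁅(a : g), s.coadL ξ y⁆)) := by
      rw [s.coe_coadG]
      simp only [map_sub, map_neg, leftTrans_dressD, lie_inr_inl, dressD_add, dressD_neg,
        dressD_inr, leftTrans_omegaG, map_add, Derivation.map_algebraMap, hN x hx, hN y hy,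
        LinearMap.add_apply, LinearMap.sub_apply]
      linear_combination hc'
    rw [h2]
    exact Submodule.sub_mem _ (Submodule.sub_mem _ (Submodule.neg_mem _
      (Submodule.subset_span ⟨_, _, hx, _, hy, rfl⟩))
      (Submodule.subset_span ⟨_, _, s.coadL_mem_u ξ hx, _, hy, rfl⟩))
      (Submodule.subset_span ⟨_, _, hx, _, s.coadL_mem_u ξ hy, rfl⟩)

end IsSplitting

end PLDyn

namespace PLDyn

open LieBialgebra LieDual

/-! ### Tensors with coefficients in a commutative algebra -/

section Coefficients

variable {K V W M R : Type*} [Field K] [AddCommGroup V] [Module K V] [AddCommGroup W] [Module K W]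
  [AddCommGroup M] [Module K M] [CommRing R] [Algebra K R]

/-- `m ⊗ r ↦ f(m) r`. -/
def evalR (f : M →ₗ[K] R) : M ⊗[K] R →ₗ[K] R := LinearMap.mul' K R ∘ₗ LinearMap.rTensor R f

@[simp] theorem evalR_tmul (f : M →ₗ[K] R) (m : M) (r : R) : evalR f (m ⊗ₜ r) = f m * r := rfl

/-- `a ⊗ b ⊗ r ↦ a ⊗ φ(b) r`. -/
def contrR (φ : V →ₗ[K] R) : (V ⊗[K] V) ⊗[K] R →ₗ[K] V ⊗[K] R :=
  LinearMap.lTensor V (evalR φ) ∘ₗ (TensorProduct.assoc K V V R).toLinearMap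

@[simp] theorem contrR_tmul (φ : V →ₗ[K] R) (a b : V) (r : R) :
    contrR φ ((a ⊗ₜ b) ⊗ₜ r) = a ⊗ₜ (φ b * r) := rfl

/-- Induction on tensors in `V ⊗ V ⊗ R`. -/
theorem tensor3_induction {p : (V ⊗[K] V) ⊗[K] R → Prop} (h0 : p 0)
    (ht : ∀ a b r, p ((a ⊗ₜ b) ⊗ₜ r)) (ha : ∀ s t, p s → p t → p (s + t))
    (t : (V ⊗[K] V) ⊗[K] R) : p t := by
  induction t with
  | zero => exact h0
  | tmul s r =>
    induction s with
    | zero => rw [TensorProduct.zero_tmul]; exact h0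
    | tmul a b => exact ht a b r
    | add s t hs ht => rw [TensorProduct.add_tmul]; exact ha _ _ hs ht
  | add s t hs ht => exact ha _ _ hs ht

theorem evalR_rTensor (f : M →ₗ[K] R) (h : W →ₗ[K] M) (t : W ⊗[K] R) :
    evalR f (LinearMap.rTensor R h t) = evalR (f ∘ₗ h) t := by
  simp [evalR, LinearMap.rTensor_comp]

theorem evalR_add (f f' : M →ₗ[K] R) (t : M ⊗[K] R) :
    evalR (f + f') t = evalR f t + evalR f' t := by
  simp [evalR, LinearMap.rTensor_add]

theorem evalR_smul (r : R) (f : M →ₗ[K] R) (t : M ⊗[K] R) :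
    evalR (r • f) t = r * evalR f t := by
  induction t with
  | zero => simp
  | tmul m r' => simp [mul_assoc]
  | add s t hs ht => simp only [map_add, hs, ht, mul_add]

/-- Evaluation in two stages: once a contraction is a constant `y ⊗ 1`, only `φ(y)` has to be
computed. -/
theorem evalR_eval2 (φ ψ : V →ₗ[K] R) (t : (V ⊗[K] V) ⊗[K] R) :
    evalR (eval2 φ ψ) t = evalR φ (contrR ψ t) := by
  induction t using tensor3_induction with
  | h0 => simp
  | ht a b r => simp [mul_assoc]
  | ha s t hs ht => simp only [map_add, hs, ht]

theorem evalR_eval2_swap (φ ψ : V →ₗ[K] R) {t : (V ⊗[K] V) ⊗[K] R}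
    (ht : LinearMap.rTensor R (TensorProduct.comm K V V).toLinearMap t = -t) :
    evalR (eval2 φ ψ) t = -evalR (eval2 ψ φ) t := by
  have h : eval2 φ ψ ∘ₗ (TensorProduct.comm K V V).toLinearMap = eval2 ψ φ :=
    LinearMap.ext fun t => eval2_comm φ ψ t
  rw [← h, ← evalR_rTensor, ht, map_neg, neg_neg]

theorem contrR_rTensor_map (φ : W →ₗ[K] R) (f : V →ₗ[K] W) (t : (V ⊗[K] V) ⊗[K] R) :
    contrR φ (LinearMap.rTensor R (TensorProduct.map f f) t) =
      LinearMap.rTensor R f (contrR (φ ∘ₗ f) t) := by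
  induction t using tensor3_induction with
  | h0 => simp
  | ht a b r => simp
  | ha s t hs ht => simp only [map_add, hs, ht]

theorem contrR_zero (t : (V ⊗[K] V) ⊗[K] R) : contrR (0 : V →ₗ[K] R) t = 0 := by
  induction t using tensor3_induction with
  | h0 => simp
  | ht a b r => simp
  | ha s t hs ht => rw [map_add, hs, ht, add_zero]

/-- The coefficients of a tensor with respect to a basis are obtained by evaluation. -/
theorem eq_zero_of_evalR_coord {κ : Type*} (B : Module.Basis κ K M) {t : M ⊗[K] R}
    (h : ∀ i, evalR (Algebra.linearMap K R ∘ₗ B.coord i) t = 0) : t = 0 := by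
  classical
  apply (TensorProduct.equivFinsuppOfBasisLeft B).injective
  rw [map_zero]
  ext i
  rw [Finsupp.zero_apply, ← h i]
  clear h
  induction t with
  | zero => simp
  | tmul m r => simp [Algebra.smul_def]
  | add s t hs ht => simp only [map_add, Finsupp.add_apply, hs, ht]

theorem eval2_smul_left (r : R) (φ ψ : V →ₗ[K] R) : eval2 (r • φ) ψ = r • eval2 φ ψ :=
  TensorProduct.ext' fun a b => by simp [mul_assoc]

theorem eval2_smul_right (r : R) (φ ψ : V →ₗ[K] R) : eval2 φ (r • ψ) = r • eval2 φ ψ :=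
  TensorProduct.ext' fun a b => by simp [mul_left_comm]

/-- `eval2` as a bilinear map. -/
def eval2Lin : (V →ₗ[K] R) →ₗ[R] (V →ₗ[K] R) →ₗ[R] (V ⊗[K] V →ₗ[K] R) :=
  LinearMap.mk₂ R eval2
    (fun _ _ _ => LinearMap.ext fun _ => eval2_add_left _ _ _ _) eval2_smul_left
    (fun _ _ _ => LinearMap.ext fun _ => eval2_add_right _ _ _ _) eval2_smul_right

/-- `a ⊗ t ↦ φ(a) f(t)`, as a bilinear map in `φ` and `f`. -/
def evalConsLin : (V →ₗ[K] R) →ₗ[R] (W →ₗ[K] R) →ₗ[R] (V ⊗[K] W →ₗ[K] R) :=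
  LinearMap.mk₂ R (fun φ f => LinearMap.mul' K R ∘ₗ TensorProduct.map φ f)
    (fun _ _ _ => TensorProduct.ext' fun a b => by simp [add_mul])
    (fun _ _ _ => TensorProduct.ext' fun a b => by simp [mul_assoc])
    (fun _ _ _ => TensorProduct.ext' fun a b => by simp [mul_add])
    (fun _ _ _ => TensorProduct.ext' fun a b => by simp [mul_left_comm])

/-- `evalR` as a linear map in the functional. -/
def evalRLin (t : M ⊗[K] R) : (M →ₗ[K] R) →ₗ[R] R where
  toFun f := evalR f t
  map_add' f f' := evalR_add f f' t
  map_smul' r f := evalR_smul r f t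

/-- A tensor in `V ⊗ W ⊗ R` vanishes if it does so on products of functionals from spanning
sets. -/
theorem eq_zero_of_evalR_span [FiniteDimensional K V] [FiniteDimensional K W]
    {S : Set (V →ₗ[K] R)} (hS : Submodule.span R S = ⊤) {S' : Set (W →ₗ[K] R)}
    (hS' : Submodule.span R S' = ⊤) {t : (V ⊗[K] W) ⊗[K] R}
    (h : ∀ φ ∈ S, ∀ f ∈ S', evalR (LinearMap.mul' K R ∘ₗ TensorProduct.map φ f) t = 0) :
    t = 0 := by
  -- The evaluation is `R`-bilinear in the pair of functionals, so its vanishing spreads to all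
  -- pairs, in particular to pairs of coordinate functionals, which read off the coefficients of
  -- `t`.
  have h0 : (evalConsLin (K := K) (V := V) (W := W)).compr₂ (evalRLin t) = 0 := by
    apply LinearMap.ext_on hS
    intro φ hφ
    apply LinearMap.ext_on hS'
    intro f hf
    exact h φ hφ f hf
  refine eq_zero_of_evalR_coord
    ((Module.finBasis K V).tensorProduct (Module.finBasis K W)) fun ⟨i, j⟩ => ?_
  have h1 := congrArg (fun F : (V →ₗ[K] R) →ₗ[R] (W →ₗ[K] R) →ₗ[R] R =>
    F (Algebra.linearMap K R ∘ₗ (Module.finBasis K V).coord i)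
      (Algebra.linearMap K R ∘ₗ (Module.finBasis K W).coord j)) h0
  have h2 : Algebra.linearMap K R ∘ₗ
      ((Module.finBasis K V).tensorProduct (Module.finBasis K W)).coord (i, j) =
      LinearMap.mul' K R ∘ₗ TensorProduct.map
        (Algebra.linearMap K R ∘ₗ (Module.finBasis K V).coord i)
        (Algebra.linearMap K R ∘ₗ (Module.finBasis K W).coord j) :=
    TensorProduct.ext' fun a b => by
      simp [Module.Basis.tensorProduct_repr_tmul_apply, mul_comm]
  rw [h2]
  exact h1

/-- Products of functionals from a spanning set span the functionals on `V ⊗ V`. -/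
theorem span_eval2 [FiniteDimensional K V] {S : Set (V →ₗ[K] R)}
    (hS : Submodule.span R S = ⊤) :
    Submodule.span R {f : V ⊗[K] V →ₗ[K] R | ∃ φ ∈ S, ∃ ψ ∈ S, f = eval2 φ ψ} = ⊤ := by
  set T := Submodule.span R {f : V ⊗[K] V →ₗ[K] R | ∃ φ ∈ S, ∃ ψ ∈ S, f = eval2 φ ψ}
  have h1 : ∀ φ ψ, eval2 φ ψ ∈ T := by
    have h0 : (eval2Lin (K := K) (V := V) (R := R)).compr₂ T.mkQ = 0 := by
      apply LinearMap.ext_on hS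
      intro φ hφ
      apply LinearMap.ext_on hS
      intro ψ hψ
      exact (Submodule.Quotient.mk_eq_zero T).2 (Submodule.subset_span ⟨φ, hφ, ψ, hψ, rfl⟩)
    intro φ ψ
    exact (Submodule.Quotient.mk_eq_zero T).1 (congrArg
      (fun F : (V →ₗ[K] R) →ₗ[R] (V →ₗ[K] R) →ₗ[R] _ => F φ ψ) h0)
  rw [eq_top_iff]
  intro f _
  let B := Module.finBasis K V
  have hf : f = ∑ i, ∑ j, f (B i ⊗ₜ B j) •
      eval2 (Algebra.linearMap K R ∘ₗ B.coord i) (Algebra.linearMap K R ∘ₗ B.coord j) := by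
    refine (B.tensorProduct B).ext fun ⟨i, j⟩ => ?_
    simp [Module.Basis.tensorProduct_apply, Finsupp.single_apply, LinearMap.sum_apply]
  rw [hf]
  exact Submodule.sum_mem _ fun i _ => Submodule.sum_mem _ fun j _ => Submodule.smul_mem _ _ (h1 _ _)

theorem evalR_eval2_lTensor (D : Derivation K R R) (φ ψ : V →ₗ[K] R) (t : (V ⊗[K] V) ⊗[K] R) :
    evalR (eval2 φ ψ) (LinearMap.lTensor (V ⊗[K] V) (D : R →ₗ[K] R) t) =
      D (evalR (eval2 φ ψ) t) - evalR (eval2 ((D : R →ₗ[K] R) ∘ₗ φ) ψ) t -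
        evalR (eval2 φ ((D : R →ₗ[K] R) ∘ₗ ψ)) t := by
  induction t using tensor3_induction with
  | h0 => simp
  | ht a b r => simp; ring
  | ha s t hs ht => simp only [map_add, hs, ht]; ring

/-- For antisymmetric `t` whose contractions with `φ` and `ψ` are constant, the derivative of `t`
is computed by that of the functionals. -/
theorem evalR_eval2_lTensor_of_contrR (D : Derivation K R R) {φ ψ : V →ₗ[K] R} {x y : V}
    {t : (V ⊗[K] V) ⊗[K] R}
    (ht : LinearMap.rTensor R (TensorProduct.comm K V V).toLinearMap t = -t)
    (hφ : contrR φ t = x ⊗ₜ 1) (hψ : contrR ψ t = y ⊗ₜ 1) :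
    evalR (eval2 φ ψ) (LinearMap.lTensor (V ⊗[K] V) (D : R →ₗ[K] R) t) = D (ψ x) := by
  -- In the Leibniz rule the first two terms are both `D(φ y)` and cancel; antisymmetry turns the
  -- third into `D(ψ x)`.
  rw [evalR_eval2_lTensor, evalR_eval2_swap φ ((D : R →ₗ[K] R) ∘ₗ ψ) ht, evalR_eval2, evalR_eval2, evalR_eval2, hφ, hψ]
  simp

theorem eval3_comp_cyc (φ ψ χ : V →ₗ[K] R) : eval3 φ ψ χ ∘ₗ cyc K V = eval3 χ φ ψ :=
  TensorProduct.ext_threefold' fun a b c => by simp [cyc_tmul]; ring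

theorem eval3_comp_alt (φ ψ χ : V →ₗ[K] R) :
    eval3 φ ψ χ ∘ₗ alt K V = eval3 φ ψ χ + eval3 χ φ ψ + eval3 ψ χ φ := by
  rw [alt, LinearMap.comp_add, LinearMap.comp_add, LinearMap.comp_id, ← LinearMap.comp_assoc,
    eval3_comp_cyc, eval3_comp_cyc]

theorem eval3_comp_tensorId (φ ψ χ : V →ₗ[K] R) (f : V →ₗ[K] V ⊗[K] V) :
    eval3 φ ψ χ ∘ₗ tensorId f = eval2 (eval2 φ ψ ∘ₗ f) χ := by
  have key : ∀ (s : V ⊗[K] V) (b : V),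
      eval3 φ ψ χ (TensorProduct.assoc K V V V (s ⊗ₜ b)) = eval2 φ ψ s * χ b := by
    intro s b
    induction s with
    | zero => simp
    | tmul a c => simp [mul_assoc]
    | add s t hs ht => rw [TensorProduct.add_tmul]; simp [hs, ht, add_mul]
  exact TensorProduct.ext' fun a b => by simp [tensorId, key]

end Coefficients

/-! ### Evaluation of `CYB` and of the adjoint action -/

section Bracket

variable {K g R : Type*} [Field K] [LieRing g] [LieAlgebra K g] [CommRing R] [Algebra K R]

/-- `(x ⊗ r, y ⊗ s) ↦ φ([x, y]) r s`. -/
def bracketEval (φ : g →ₗ[K] R) : g ⊗[K] R →ₗ[K] g ⊗[K] R →ₗ[K] R :=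
  (TensorProduct.map₂ (LieModule.toEnd K g g : g →ₗ[K] Module.End K g)
    (LinearMap.mul K R)).compr₂ (evalR φ)

@[simp] theorem bracketEval_tmul (φ : g →ₗ[K] R) (x y : g) (r r' : R) :
    bracketEval φ (x ⊗ₜ r) (y ⊗ₜ r') = φ ⁅x, y⁆ * (r * r') := rfl

/-- The contraction of the first factor. -/
theorem contrR_comm_tmul (φ : g →ₗ[K] R) (a b : g) (r : R) :
    contrR φ (LinearMap.rTensor R (TensorProduct.comm K g g).toLinearMap ((a ⊗ₜ b) ⊗ₜ r)) =
      b ⊗ₜ (φ a * r) := rfl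

theorem evalR_br12_13 (φ ψ χ : g →ₗ[K] R) (t t' : (g ⊗[K] g) ⊗[K] R) :
    evalR (eval3 φ ψ χ) (TensorProduct.map₂ (br12_13 K g) (LinearMap.mul K R) t t') =
      bracketEval φ (contrR ψ t) (contrR χ t') := by
  induction t using tensor3_induction with
  | h0 => simp
  | ht a b r =>
    induction t' using tensor3_induction with
    | h0 => simp
    | ht a' b' r' => simp [br12_13_tmul]; ring
    | ha s t hs ht => simp only [map_add, hs, ht]
  | ha s t hs ht => simp only [map_add, LinearMap.add_apply, hs, ht]

/-- Here the free slot of `t` is the first one, while `contrR` contracts the second; hence the flip,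
which becomes a sign for antisymmetric tensors. -/
theorem evalR_br12_23 (φ ψ χ : g →ₗ[K] R) (t t' : (g ⊗[K] g) ⊗[K] R) :
    evalR (eval3 φ ψ χ) (TensorProduct.map₂ (br12_23 K g) (LinearMap.mul K R) t t') =
      bracketEval ψ (contrR φ (LinearMap.rTensor R (TensorProduct.comm K g g).toLinearMap t))
        (contrR χ t') := by
  induction t using tensor3_induction with
  | h0 => simp
  | ht a b r =>
    induction t' using tensor3_induction with
    | h0 => simp
    | ht a' b' r' =>
      simp only [contrR_comm_tmul, contrR_tmul, TensorProduct.map₂_apply_tmul, TensorProduct.map_tmul,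
        br12_23_tmul,
        LinearMap.mul_apply', evalR_tmul, eval3_tmul, bracketEval_tmul]
      ring
    | ha s t hs ht => simp only [map_add, hs, ht]
  | ha s t hs ht => simp only [map_add, LinearMap.add_apply, hs, ht]

theorem evalR_br13_23 (φ ψ χ : g →ₗ[K] R) (t t' : (g ⊗[K] g) ⊗[K] R) :
    evalR (eval3 φ ψ χ) (TensorProduct.map₂ (br13_23 K g) (LinearMap.mul K R) t t') =
      bracketEval χ (contrR φ (LinearMap.rTensor R (TensorProduct.comm K g g).toLinearMap t))
        (contrR ψ (LinearMap.rTensor R (TensorProduct.comm K g g).toLinearMap t')) := by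
  induction t using tensor3_induction with
  | h0 => simp
  | ht a b r =>
    induction t' using tensor3_induction with
    | h0 => simp
    | ht a' b' r' =>
      simp only [contrR_comm_tmul, TensorProduct.map₂_apply_tmul, TensorProduct.map_tmul,
        br13_23_tmul,
        LinearMap.mul_apply', evalR_tmul, eval3_tmul, bracketEval_tmul]
      ring
    | ha s t hs ht => simp only [map_add, hs, ht]
  | ha s t hs ht => simp only [map_add, LinearMap.add_apply, hs, ht]

theorem map₂_add_left' (f f' : g ⊗[K] g →ₗ[K] g ⊗[K] g →ₗ[K] g ⊗[K] (g ⊗[K] g))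
    (t t' : (g ⊗[K] g) ⊗[K] R) :
    TensorProduct.map₂ (f + f') (LinearMap.mul K R) t t' =
      TensorProduct.map₂ f (LinearMap.mul K R) t t' +
        TensorProduct.map₂ f' (LinearMap.mul K R) t t' := by
  induction t with
  | zero => simp
  | tmul m r =>
    induction t' with
    | zero => simp
    | tmul m' r' => simp [TensorProduct.add_tmul]
    | add s t hs ht => simp only [map_add, hs, ht]; abel
  | add s t hs ht => simp only [map_add, LinearMap.add_apply, hs, ht]; abel

/-- Evaluation of `CYB(ρ)` on functionals whose contractions with the antisymmetric tensor `ρ` are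
constant. -/
theorem evalR_CYB {φ ψ χ : g →ₗ[K] R} {x y z : g} {ρ : (g ⊗[K] g) ⊗[K] R}
    (hρ : LinearMap.rTensor R (TensorProduct.comm K g g).toLinearMap ρ = -ρ)
    (hφ : contrR φ ρ = x ⊗ₜ 1) (hψ : contrR ψ ρ = y ⊗ₜ 1) (hχ : contrR χ ρ = z ⊗ₜ 1) :
    evalR (eval3 φ ψ χ) (CYB ρ) = φ ⁅y, z⁆ + ψ ⁅z, x⁆ + χ ⁅x, y⁆ := by
  rw [CYB, map₂_add_left', map₂_add_left', map_add, map_add, evalR_br12_13, evalR_br12_23,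
    evalR_br13_23, hρ, map_neg, map_neg (contrR ψ), hφ, hψ, hχ, ← lie_skew z x, map_neg ψ]
  simp only [map_neg, LinearMap.neg_apply, bracketEval_tmul, mul_one]
  ring

/-- Evaluation of the adjoint action on functionals whose contractions with the antisymmetric tensor
`ρ` are constant. -/
theorem evalR_eval2_adjoint {ρ : (g ⊗[K] g) ⊗[K] R}
    (hρ : LinearMap.rTensor R (TensorProduct.comm K g g).toLinearMap ρ = -ρ)
    (a : g) {φ ψ : g →ₗ[K] R} {x y : g}
    (hφ : contrR φ ρ = x ⊗ₜ 1) (hψ : contrR ψ ρ = y ⊗ₜ 1) :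
    evalR (eval2 φ ψ) (LinearMap.rTensor R (LieModule.toEnd K g (g ⊗[K] g) a) ρ) =
      φ ⁅a, y⁆ - ψ ⁅a, x⁆ := by
  let A : g →ₗ[K] g := LieAlgebra.ad K g a
  have h : eval2 φ ψ ∘ₗ LieModule.toEnd K g (g ⊗[K] g) a =
      eval2 (φ ∘ₗ A) ψ + eval2 φ (ψ ∘ₗ A) :=
    TensorProduct.ext' fun x y => by
      simp [TensorProduct.LieModule.lie_tmul_right, A]
  rw [evalR_rTensor, h, evalR_add, evalR_eval2_swap φ (ψ ∘ₗ A) hρ, evalR_eval2, evalR_eval2, hφ, hψ]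
  simp [A, sub_eq_add_neg]

end Bracket

end PLDyn

namespace PLDyn

open LieBialgebra LieDual

/-! ### Inverting a bilinear form -/

section Inverse

variable {K V R ι : Type*} [Field K] [AddCommGroup V] [Module K V] [CommRing R] [Algebra K R]
  [Fintype ι] [DecidableEq ι] (b : Module.Basis ι K V) {B : V →ₗ[K] V →ₗ[K] R}

/-- The functionals `B(b_i, ·)` span all functionals if the determinant of `B` is invertible. -/
theorem exists_eq_sum_smul_form (hB : IsUnit (Matrix.of fun i j => B (b i) (b j)).det)
    (φ : V →ₗ[K] R) : ∃ r : ι → R, φ = ∑ i, r i • B (b i) := by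
  set M := Matrix.of fun i j => B (b i) (b j)
  refine ⟨Matrix.vecMul (fun j => φ (b j)) M⁻¹, b.ext fun j => ?_⟩
  have h : Matrix.vecMul (Matrix.vecMul (fun j => φ (b j)) M⁻¹) M = fun j => φ (b j) := by
    rw [Matrix.vecMul_vecMul, Matrix.nonsing_inv_mul M hB, Matrix.vecMul_one]
  have hj := congrFun h j
  rw [← hj]
  simp [Matrix.vecMul, dotProduct, LinearMap.sum_apply, M]

theorem span_range_form (hB : IsUnit (Matrix.of fun i j => B (b i) (b j)).det) :
    Submodule.span R (Set.range B) = ⊤ := by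
  rw [eq_top_iff]
  intro φ _
  obtain ⟨r, rfl⟩ := exists_eq_sum_smul_form b hB φ
  exact Submodule.sum_mem _ fun i _ => Submodule.smul_mem _ _ (Submodule.subset_span ⟨_, rfl⟩)

theorem exists_contrR_eq (hB : IsUnit (Matrix.of fun i j => B (b i) (b j)).det) :
    ∃ t : (V ⊗[K] V) ⊗[K] R, ∀ v, contrR (B v) t = v ⊗ₜ 1 := by
  set M := Matrix.of fun i j => B (b i) (b j)
  have hM : IsUnit M.transpose.det := by rwa [Matrix.det_transpose]
  -- The transpose appears because `contrR` pairs the second factor `b j` with the second argument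
  -- of `B`: the requirement is `∑ j, S i j * B (b k) (b j) = δ_{ik}`.
  let S := M.transpose⁻¹
  refine ⟨∑ i, ∑ j, (b i ⊗ₜ b j) ⊗ₜ S i j, fun v => ?_⟩
  have key : ∀ i, ∑ j, LinearMap.mulRight K (S i j) ∘ₗ B.flip (b j) =
      Algebra.linearMap K R ∘ₗ b.coord i := fun i => by
    refine b.ext fun k => ?_
    have h := congrFun (congrFun (Matrix.nonsing_inv_mul M.transpose hM) i) k
    rw [Matrix.mul_apply] at h
    simp only [LinearMap.sum_apply, LinearMap.comp_apply, LinearMap.mulRight_apply,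
      LinearMap.flip_apply, Module.Basis.coord_apply, Module.Basis.repr_self,
      Algebra.linearMap_apply]
    calc ∑ j, B (b k) (b j) * S i j = ∑ j, M.transpose⁻¹ i j * M.transpose j k :=
          Finset.sum_congr rfl fun j _ => mul_comm _ _
      _ = _ := by
        rw [h, Matrix.one_apply, Finsupp.single_apply]
        by_cases hik : i = k
        · simp [hik]
        · simp [hik, Ne.symm hik]
  have key' : ∀ i, ∑ j, B v (b j) * S i j = algebraMap K R (b.repr v i) := fun i => by
    have := congrArg (fun F : V →ₗ[K] R => F v) (key i)
    simpa [LinearMap.sum_apply] using this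
  simp only [map_sum, contrR_tmul]
  simp only [← TensorProduct.tmul_sum, key', Algebra.algebraMap_eq_smul_one,
    TensorProduct.tmul_smul, TensorProduct.smul_tmul']
  rw [← TensorProduct.sum_tmul, b.sum_repr]

theorem eq_zero_of_contrR [FiniteDimensional K V]
    (hB : IsUnit (Matrix.of fun i j => B (b i) (b j)).det) {t : (V ⊗[K] V) ⊗[K] R}
    (ht : ∀ v, contrR (B v) t = 0) : t = 0 := by
  refine eq_zero_of_evalR_span (S := Set.univ) Submodule.span_univ (span_range_form b hB) ?_
  rintro φ - _ ⟨v, rfl⟩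
  change evalR (eval2 φ (B v)) t = 0
  rw [evalR_eval2, ht, map_zero]

/-- The inverse of an antisymmetric form is antisymmetric. -/
theorem rTensor_comm_of_contrR [FiniteDimensional K V]
    (hB : IsUnit (Matrix.of fun i j => B (b i) (b j)).det) (hB' : ∀ v w, B v w = -B w v)
    {t : (V ⊗[K] V) ⊗[K] R} (ht : ∀ v, contrR (B v) t = v ⊗ₜ 1) :
    LinearMap.rTensor R (TensorProduct.comm K V V).toLinearMap t = -t := by
  rw [eq_neg_iff_add_eq_zero]
  refine eq_zero_of_evalR_span (span_range_form b hB) (span_range_form b hB) ?_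
  rintro _ ⟨v, rfl⟩ _ ⟨w, rfl⟩
  change evalR (eval2 (B v) (B w)) _ = 0
  have h : eval2 (B v) (B w) ∘ₗ (TensorProduct.comm K V V).toLinearMap = eval2 (B w) (B v) :=
    LinearMap.ext fun t => eval2_comm _ _ t
  -- On the pair `B v`, `B w` the tensor `t` takes the value `B v w`, so antisymmetry passes from
  -- `B` to `t`.
  rw [map_add, evalR_rTensor, h, evalR_eval2, evalR_eval2, ht, ht, evalR_tmul, evalR_tmul,
    hB' v w]
  simp

variable (K V) in
/-- The antisymmetrization `t ↦ (t - t^{2,1}) / 2`. -/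
def antisymmetrize [CharZero K] : V ⊗[K] V →ₗ[K] wedge2 K V :=
  LinearMap.codRestrict (wedge2 K V)
    ((2 : K)⁻¹ • (LinearMap.id - (TensorProduct.comm K V V).toLinearMap)) fun t => by
      rw [mem_wedge2]
      simp only [LinearMap.smul_apply, LinearMap.sub_apply, LinearMap.id_apply, map_smul, map_sub,
        LinearEquiv.coe_coe]
      rw [← smul_neg, neg_sub]
      congr 2
      exact (TensorProduct.comm K V V).symm_apply_apply t

theorem exists_wedge2_of_rTensor_comm [CharZero K] {t : (V ⊗[K] V) ⊗[K] R}
    (ht : LinearMap.rTensor R (TensorProduct.comm K V V).toLinearMap t = -t) :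
    ∃ σ : wedge2 K V ⊗[K] R, LinearMap.rTensor R (wedge2 K V).subtype σ = t := by
  refine ⟨LinearMap.rTensor R (antisymmetrize K V) t, ?_⟩
  rw [← LinearMap.comp_apply, ← LinearMap.rTensor_comp, antisymmetrize,
    LinearMap.subtype_comp_codRestrict, LinearMap.rTensor_smul, LinearMap.rTensor_sub,
    LinearMap.smul_apply, LinearMap.sub_apply, ht, LinearMap.rTensor_id, LinearMap.id_apply,
    sub_neg_eq_add, ← two_smul K t, smul_smul, inv_mul_cancel₀ two_ne_zero, one_smul]

end Inverse

/-! ### The dynamical r-matrix -/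

namespace IsSplitting

variable {K g : Type*} [Field K] [CharZero K] [LieRing g] [LieAlgebra K g] [LieBialgebra K g]
  {l : LieSubbialgebra K g} {u : Submodule K g} (s : IsSplitting l u)
  (R : Type*) [CommRing R] [Algebra K R] [Algebra (DualFun l) R] [IsScalarTower K (DualFun l) R]

/-- The form `ω` on `g` with values in an algebra `R` over `K[[L^*]]`. -/
def omegaLoc : g →ₗ[K] g →ₗ[K] R :=
  s.omegaG.compr₂ ((Algebra.linearMap (DualFun l) R).restrictScalars K)

theorem omegaLoc_apply (x y : g) : s.omegaLoc R x y = algebraMap _ R (s.omegaG x y) := rfl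

theorem omegaLoc_swap (x y : g) : s.omegaLoc R x y = -s.omegaLoc R y x := by
  rw [omegaLoc_apply, omegaG_swap, map_neg, omegaLoc_apply]

theorem omegaLoc_u_l {v : g} (hv : v ∈ u) (a : l.toLieSubalgebra) :
    s.omegaLoc R v (a : g) = 0 := by
  rw [omegaLoc_apply, s.omegaG_u_l hv, map_zero]

theorem eval2_omegaLoc (x y : g) (t : g ⊗[K] g) :
    eval2 (s.omegaLoc R x) (s.omegaLoc R y) t =
      algebraMap _ R (eval2 (s.omegaG x) (s.omegaG y) t) := by
  induction t with
  | zero => simp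
  | tmul a b => rw [eval2_tmul, eval2_tmul, map_mul]; rfl
  | add s t hs ht => rw [map_add, map_add, map_add, hs, ht]

/-- The `R`-valued functional on `g` defined by `ξ ∈ l^*`. -/
def dualLoc (ξ : LieDual K l.toLieSubalgebra) : g →ₗ[K] R :=
  scalarDual R (s.extendDual ξ)

theorem dualLoc_apply (ξ : LieDual K l.toLieSubalgebra) (x : g) :
    s.dualLoc R ξ x = algebraMap K R (toDual (s.extendDual ξ) x) := rfl

theorem dualLoc_of_mem_u (ξ : LieDual K l.toLieSubalgebra) {v : g} (hv : v ∈ u) :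
    s.dualLoc R ξ v = 0 := by
  rw [dualLoc_apply, s.extendDual_of_mem_u ξ hv, map_zero]

/-- The functionals `ω(v, ·)` for `v ∈ u` and `ξ ∈ l^*`, which serve to test tensors. -/
def testFunctionals : Set (g →ₗ[K] R) :=
  {φ | (∃ v ∈ u, φ = s.omegaLoc R v) ∨ ∃ ξ, φ = s.dualLoc R ξ}

theorem isUnit_det_omegaLoc {ι : Type*} [Fintype ι] [DecidableEq ι] (b : Module.Basis ι K u)
    (hP : IsUnit (algebraMap _ R (s.detOmega b))) :
    IsUnit (Matrix.of fun i j => (s.omegaLoc R).compl₁₂ u.subtype u.subtype (b i) (b j)).det := by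
  have h : (Matrix.of fun i j => (s.omegaLoc R).compl₁₂ u.subtype u.subtype (b i) (b j)).det =
      algebraMap _ R (s.detOmega b) :=
    (RingHom.map_det (algebraMap _ R) (Matrix.of fun i j => s.omega (b i) (b j))).symm
  rwa [h]

variable [FiniteDimensional K g]

/-- The functionals `ω(v, ·)` vanish on `l` and restrict to a spanning set on `u`, where the
determinant is invertible; those from `l^*` vanish on `u` and span on `l`. The two restrictions can
thus be matched separately. -/
theorem span_testFunctionals {ι : Type*} [Fintype ι] [DecidableEq ι] (b : Module.Basis ι K u)
    (hP : IsUnit (algebraMap _ R (s.detOmega b))) :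
    Submodule.span R (s.testFunctionals R) = ⊤ := by
  rw [eq_top_iff]
  intro φ _
  obtain ⟨r, hr⟩ := exists_eq_sum_smul_form b (s.isUnit_det_omegaLoc R b hP) (φ ∘ₗ u.subtype)
  let e := stdBasis K l.toLieSubalgebra
  have hφ : φ = ∑ i, r i • s.omegaLoc R (b i : g) +
      ∑ i, φ (e i : g) • s.dualLoc R (dualVec K l.toLieSubalgebra i) := by
    refine LinearMap.ext fun x => ?_
    have hx : x ∈ l.toLieSubalgebra.toSubmodule ⊔ u := by
      rw [s.isCompl.sup_eq_top]; trivial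
    obtain ⟨y, hy, z, hz, rfl⟩ := Submodule.mem_sup.1 hx
    have hz' := congrArg (fun F : u →ₗ[K] R => F ⟨z, hz⟩) hr
    simp only [LinearMap.comp_apply, Submodule.subtype_apply, LinearMap.sum_apply,
      LinearMap.smul_apply, LinearMap.compl₁₂_apply] at hz'
    have hy0 : ∀ i, s.omegaLoc R (b i : g) y = 0 := fun i =>
      s.omegaLoc_u_l R (b i).2 ⟨y, hy⟩
    have hz0 : ∀ ξ, s.dualLoc R ξ z = 0 := fun ξ => s.dualLoc_of_mem_u R ξ hz
    have hyl : ∀ i, s.dualLoc R (dualVec K l.toLieSubalgebra i) y =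
        algebraMap K R (e.repr ⟨y, hy⟩ i) := fun i => by
      rw [dualLoc_apply]
      congr 1
      exact s.extendDual_coe _ ⟨y, hy⟩
    have hφy : φ y = ∑ i, φ (e i : g) * algebraMap K R (e.repr ⟨y, hy⟩ i) := by
      have h1 := congrArg (φ ∘ₗ l.toLieSubalgebra.toSubmodule.subtype) (e.sum_repr ⟨y, hy⟩)
      rw [map_sum] at h1
      refine h1.symm.trans (Finset.sum_congr rfl fun i _ => ?_)
      rw [map_smul, Algebra.smul_def, mul_comm]
      rfl
    simp only [LinearMap.add_apply, LinearMap.sum_apply, LinearMap.smul_apply, map_add, hy0, hz0,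
      hyl, smul_eq_mul, mul_zero, Finset.sum_const_zero, zero_add, add_zero, hz', hφy]
  rw [hφ]
  refine Submodule.add_mem _ (Submodule.sum_mem _ fun i _ => Submodule.smul_mem _ _
    (Submodule.subset_span (Or.inl ⟨_, (b i).2, rfl⟩))) (Submodule.sum_mem _ fun i _ =>
    Submodule.smul_mem _ _ (Submodule.subset_span (Or.inr ⟨_, rfl⟩)))

variable {s R} {ρ : (g ⊗[K] g) ⊗[K] R}

/-- Equivariance of the inverse of `ω` under the dressing action. -/
theorem equivariant_of_contrR
    (hspan : Submodule.span R (s.testFunctionals R) = ⊤)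
    (hρ : LinearMap.rTensor R (TensorProduct.comm K g g).toLinearMap ρ = -ρ)
    (hω : ∀ v ∈ u, contrR (s.omegaLoc R v) ρ = v ⊗ₜ 1)
    (hl : ∀ ξ, contrR (s.dualLoc R ξ) ρ = (0 : g) ⊗ₜ 1)
    (a : l.toLieSubalgebra) (D : Derivation K R R)
    (hD : ∀ f : DualFun l, D (algebraMap _ R f) = algebraMap _ R (dressL (K := K) a f)) :
    LinearMap.lTensor (g ⊗[K] g) (D : R →ₗ[K] R) ρ +
      LinearMap.rTensor R (LieModule.toEnd K g (g ⊗[K] g) (a : g)) ρ = 0 := by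
  refine eq_zero_of_evalR_span hspan hspan fun φ hφ ψ hψ => ?_
  change evalR (eval2 φ ψ) _ = 0
  rw [map_add]
  rcases hφ with ⟨v, hv, rfl⟩ | ⟨ξ, rfl⟩ <;> rcases hψ with ⟨w, hw, rfl⟩ | ⟨η, rfl⟩
  -- The only case with content: it is the invariance of `ω` under dressing. If a functional from
  -- `l^*` occurs, each term contains a contraction equal to `0` or a functional vanishing on `u`.
  · rw [evalR_eval2_lTensor_of_contrR _ hρ (hω v hv) (hω w hw),
      evalR_eval2_adjoint hρ _ (hω v hv) (hω w hw), omegaLoc_apply, hD,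
      dressL_eq, Derivation.neg_apply, s.dressD_omegaG a hw hv, omegaLoc_apply, omegaLoc_apply,
      s.omegaG_swap v]
    simp only [map_neg, map_sub]
    ring
  · rw [evalR_eval2_lTensor_of_contrR _ hρ (hω v hv) (hl η),
      evalR_eval2_adjoint hρ _ (hω v hv) (hl η), s.dualLoc_of_mem_u R η hv,
      s.dualLoc_of_mem_u R η (s.lie_mem a.1 a.2 v hv)]
    simp
  · rw [evalR_eval2_lTensor_of_contrR _ hρ (hl ξ) (hω w hw),
      evalR_eval2_adjoint hρ _ (hl ξ) (hω w hw), s.dualLoc_of_mem_u R ξ (s.lie_mem a.1 a.2 w hw)]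
    simp
  · rw [evalR_eval2_lTensor_of_contrR _ hρ (hl ξ) (hl η),
      evalR_eval2_adjoint hρ _ (hl ξ) (hl η)]
    simp

/-- `a ⊗ b ⊗ r ↦ -∑ i, a ⊗ b ⊗ c_i ⊗ D_i(r)`. -/
def dTensor {n : Type*} [Fintype n] (c : n → g) (D : n → Derivation K R R) :
    (g ⊗[K] g) ⊗[K] R →ₗ[K] (g ⊗[K] (g ⊗[K] g)) ⊗[K] R :=
  -∑ i, TensorProduct.map
    ((TensorProduct.assoc K g g g).toLinearMap ∘ₗ (TensorProduct.mk K (g ⊗[K] g) g).flip (c i))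
    (D i : R →ₗ[K] R)

/-- The third functional only meets the vectors `c i`, so no condition on its contraction with `ρ`
is needed. -/
theorem evalR_dTensor {n : Type*} [Fintype n] (c : n → g) (D : n → Derivation K R R)
    (hρ : LinearMap.rTensor R (TensorProduct.comm K g g).toLinearMap ρ = -ρ)
    {φ ψ : g →ₗ[K] R} (χ : g →ₗ[K] R) {x y : g}
    (hφ : contrR φ ρ = x ⊗ₜ 1) (hψ : contrR ψ ρ = y ⊗ₜ 1) :
    evalR (eval3 φ ψ χ) (dTensor c D ρ) = -∑ i, χ (c i) * D i (ψ x) := by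
  have key : ∀ (c : g) (D : Derivation K R R) (t : (g ⊗[K] g) ⊗[K] R),
      evalR (eval3 φ ψ χ) (TensorProduct.map ((TensorProduct.assoc K g g g).toLinearMap ∘ₗ
        (TensorProduct.mk K (g ⊗[K] g) g).flip c) (D : R →ₗ[K] R) t) =
      χ c * evalR (eval2 φ ψ) (LinearMap.lTensor (g ⊗[K] g) (D : R →ₗ[K] R) t) := by
    intro c D t
    induction t using tensor3_induction with
    | h0 => simp
    | ht a b r => simp; ring
    | ha s t hs ht => simp only [map_add, hs, ht, mul_add]
  rw [dTensor, LinearMap.neg_apply, map_neg, LinearMap.sum_apply, map_sum]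
  congr 1
  refine Finset.sum_congr rfl fun i _ => ?_
  rw [key, evalR_eval2_lTensor_of_contrR _ hρ hφ hψ]

/-- Evaluation of the left hand side of the dynamical Yang-Baxter equation on functionals whose
contractions with `ρ` are constant. -/
theorem evalR_cdybe {n : Type*} [Fintype n] (c : n → g) (D : n → Derivation K R R)
    (hρ : LinearMap.rTensor R (TensorProduct.comm K g g).toLinearMap ρ = -ρ)
    {φ ψ χ : g →ₗ[K] R} {x y z : g}
    (hφ : contrR φ ρ = x ⊗ₜ 1) (hψ : contrR ψ ρ = y ⊗ₜ 1) (hχ : contrR χ ρ = z ⊗ₜ 1) :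
    evalR (eval3 φ ψ χ) (CYB ρ + LinearMap.rTensor R (alt K g) (dTensor c D ρ) +
      LinearMap.rTensor R (alt K g ∘ₗ tensorId (cobracket (K := K))) ρ) =
    (φ ⁅y, z⁆ + ψ ⁅z, x⁆ + χ ⁅x, y⁆) -
    (∑ i, χ (c i) * D i (ψ x) + ∑ i, ψ (c i) * D i (φ z) + ∑ i, φ (c i) * D i (χ y)) +
    (eval2 φ ψ (cobracket z) + eval2 χ φ (cobracket y) + eval2 ψ χ (cobracket x)) := by
  have hδ : ∀ {φ ψ χ : g →ₗ[K] R} {z : g}, contrR χ ρ = z ⊗ₜ 1 →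
      evalR (eval3 φ ψ χ ∘ₗ tensorId (cobracket (K := K))) ρ = eval2 φ ψ (cobracket z) := by
    intro φ ψ χ z h
    rw [eval3_comp_tensorId, evalR_eval2, h]
    simp
  rw [map_add, map_add, evalR_CYB hρ hφ hψ hχ, evalR_rTensor, evalR_rTensor,
    ← LinearMap.comp_assoc, eval3_comp_alt, LinearMap.add_comp, LinearMap.add_comp]
  simp only [evalR_add]
  rw [evalR_dTensor c D hρ χ hφ hψ, evalR_dTensor c D hρ ψ hχ hφ, evalR_dTensor c D hρ φ hψ hχ,
    hδ hχ, hδ hψ, hδ hφ]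
  ring

/-- The dynamical Yang-Baxter equation for the inverse of `ω`. -/
theorem cdybe_of_contrR
    (hspan : Submodule.span R (s.testFunctionals R) = ⊤)
    (hρ : LinearMap.rTensor R (TensorProduct.comm K g g).toLinearMap ρ = -ρ)
    (hω : ∀ v ∈ u, contrR (s.omegaLoc R v) ρ = v ⊗ₜ 1)
    (hl : ∀ ξ, contrR (s.dualLoc R ξ) ρ = (0 : g) ⊗ₜ 1)
    (D : Fin (Module.finrank K l.toLieSubalgebra) → Derivation K R R)
    (hD : ∀ i (f : DualFun l), D i (algebraMap _ R f) =
      algebraMap _ R (leftTrans (K := K) (dualVec K l.toLieSubalgebra i) f)) :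
    CYB ρ + LinearMap.rTensor R (alt K g)
      (dTensor (fun i => (stdBasis K l.toLieSubalgebra i : g)) D ρ) +
      LinearMap.rTensor R (alt K g ∘ₗ tensorId (cobracket (K := K))) ρ = 0 := by
  have hω0 : ∀ {v : g}, v ∈ u → ∀ f : R,
      ∑ i, s.omegaLoc R v (stdBasis K l.toLieSubalgebra i : g) * D i f = 0 := fun hv f =>
    Finset.sum_eq_zero fun i _ => by rw [s.omegaLoc_u_l R hv, zero_mul]
  -- Summing over dual bases reassembles the left translation along `ξ` itself.
  have hξD : ∀ ξ (f : DualFun l),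
      ∑ i, s.dualLoc R ξ (stdBasis K l.toLieSubalgebra i : g) * D i (algebraMap _ R f) =
      algebraMap _ R (leftTrans (K := K) ξ f) := by
    intro ξ f
    conv_rhs => rw [← sum_dualVec ξ, leftTrans_sum_smul, map_sum]
    refine Finset.sum_congr rfl fun i _ => ?_
    rw [hD, dualLoc_apply, s.extendDual_coe, Algebra.smul_def, map_mul,
      ← IsScalarTower.algebraMap_apply]
  have hξL : ∀ ξ (ψ : g →ₗ[K] R) x, eval2 (s.dualLoc R ξ) ψ (cobracket x) = ψ (s.coadL ξ x) :=
    fun ξ ψ x => eval2_scalarDual_left _ ψ _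
  have hξR : ∀ ξ (ψ : g →ₗ[K] R) x, eval2 ψ (s.dualLoc R ξ) (cobracket x) = -ψ (s.coadL ξ x) :=
    fun ξ ψ x => by rw [eval2_swap_cobracket, hξL]
  have hξu : ∀ ξ η, ∀ v ∈ u, s.dualLoc R ξ (s.coadL η v) = 0 := fun ξ η v hv =>
    s.dualLoc_of_mem_u R ξ (s.coadL_mem_u η hv)
  -- The equation with one functional from `l^*`. It is the differential system for `ω(w, v)`, and
  -- the three such cases below are its cyclic rotations.
  have hone : ∀ ξ, ∀ v ∈ u, ∀ w ∈ u, s.dualLoc R ξ ⁅v, w⁆ -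
      ∑ i, s.dualLoc R ξ (stdBasis K l.toLieSubalgebra i : g) * D i (s.omegaLoc R w v) -
      s.omegaLoc R w (s.coadL ξ v) + s.omegaLoc R v (s.coadL ξ w) = 0 := by
    intro ξ v hv w hw
    rw [omegaLoc_apply, hξD, leftTrans_omegaG, map_add, map_sub, map_neg,
      ← IsScalarTower.algebraMap_apply, ← dualLoc_apply, ← omegaLoc_apply, ← omegaLoc_apply,
      s.omegaLoc_swap R v]
    ring
  refine eq_zero_of_evalR_span hspan (span_eval2 hspan) ?_
  rintro φ hφ _ ⟨ψ, hψ, χ, hχ, rfl⟩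
  change evalR (eval3 φ ψ χ) _ = 0
  rcases hφ with ⟨v, hv, rfl⟩ | ⟨ξ, rfl⟩ <;> rcases hψ with ⟨w, hw, rfl⟩ | ⟨η, rfl⟩ <;>
    rcases hχ with ⟨z, hz, rfl⟩ | ⟨ζ, rfl⟩
  -- With all three functionals from `u` the derivative terms disappear, as `ω(v, ·)` kills `l`, and
  -- `omegaCyc_eq_zero` remains.
  · rw [evalR_cdybe _ D hρ (hω v hv) (hω w hw) (hω z hz), hω0 hz, hω0 hw, hω0 hv,
      eval2_omegaLoc, eval2_omegaLoc, eval2_omegaLoc]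
    have h := congrArg (algebraMap _ R) (s.omegaCyc_eq_zero v w z)
    simp only [omegaCyc, map_add, map_zero] at h
    simp only [omegaLoc_apply]
    linear_combination h
  · rw [evalR_cdybe _ D hρ (hω v hv) (hω w hw) (hl ζ), hω0 hw, hω0 hv, hξL, hξR]
    have h := hone ζ v hv w hw
    simp only [lie_zero, zero_lie, map_zero]
    linear_combination h
  · rw [evalR_cdybe _ D hρ (hω v hv) (hl η) (hω z hz), hω0 hz, hω0 hv, hξL, hξR]
    have h := hone η z hz v hv
    simp only [lie_zero, zero_lie, map_zero]
    linear_combination h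
  -- With two functionals from `l^*` two contractions are zero, and the remaining cobracket term
  -- vanishes because `coadL` preserves `u`.
  · rw [evalR_cdybe _ D hρ (hω v hv) (hl η) (hl ζ), hω0 hv, hξL η, hξu ζ η v hv,
      s.dualLoc_of_mem_u R η hv]
    simp
  · rw [evalR_cdybe _ D hρ (hl ξ) (hω w hw) (hω z hz), hω0 hz, hω0 hw, hξL, hξR]
    have h := hone ξ w hw z hz
    simp only [lie_zero, zero_lie, map_zero]
    linear_combination h
  · rw [evalR_cdybe _ D hρ (hl ξ) (hω w hw) (hl ζ), hω0 hw, hξL ζ, hξu ξ ζ w hw,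
      s.dualLoc_of_mem_u R ζ hw]
    simp
  · rw [evalR_cdybe _ D hρ (hl ξ) (hl η) (hω z hz), hω0 hz, hξL ξ, hξu η ξ z hz,
      s.dualLoc_of_mem_u R ξ hz]
    simp
  · rw [evalR_cdybe _ D hρ (hl ξ) (hl η) (hl ζ)]
    simp

end IsSplitting

end PLDyn

namespace PLDyn

open LieBialgebra LieDual

/-! ### The inverse of `ω` is a dynamical `r`-matrix -/

section Wedge

variable {K V W R : Type*} [Field K] [AddCommGroup V] [Module K V] [AddCommGroup W] [Module K W]
  [CommRing R] [Algebra K R]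

theorem map_mem_wedge2 (f : V →ₗ[K] W) {t : V ⊗[K] V} (ht : t ∈ wedge2 K V) :
    TensorProduct.map f f t ∈ wedge2 K W := by
  rw [mem_wedge2] at ht ⊢
  rw [← TensorProduct.map_comm, ht, map_neg]

theorem rTensor_map_mem_wedge2 (f : V →ₗ[K] W) (σ : wedge2 K V ⊗[K] R) :
    LinearMap.rTensor R (TensorProduct.map f f ∘ₗ (wedge2 K V).subtype) σ ∈
      LinearMap.range (LinearMap.rTensor R (wedge2 K W).subtype) := by
  refine ⟨LinearMap.rTensor R (LinearMap.restrict (TensorProduct.map f f)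
    fun t ht => map_mem_wedge2 f ht) σ, ?_⟩
  rw [← LinearMap.comp_apply, ← LinearMap.rTensor_comp]
  rfl

theorem rTensor_comm_of_mem_wedge2 {t : (V ⊗[K] V) ⊗[K] R}
    (ht : t ∈ LinearMap.range (LinearMap.rTensor R (wedge2 K V).subtype)) :
    LinearMap.rTensor R (TensorProduct.comm K V V).toLinearMap t = -t := by
  obtain ⟨σ, rfl⟩ := ht
  induction σ with
  | zero => simp
  | tmul m r =>
    rw [LinearMap.rTensor_tmul, LinearMap.rTensor_tmul, ← TensorProduct.neg_tmul]
    congr 1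
    exact mem_wedge2.1 m.2
  | add x y hx hy => rw [map_add, map_add, hx, hy, neg_add]

theorem lTensor_lift_mul (φ : V →ₗ[K] R) (t : (V ⊗[K] V) ⊗[K] R) :
    (LinearMap.lTensor V (TensorProduct.lift ((LinearMap.mul K R).comp φ)) ∘ₗ
      (TensorProduct.assoc K V V R).toLinearMap) t = contrR φ t := by
  induction t using tensor3_induction with
  | h0 => simp
  | ht a b r => rfl
  | ha s t hs ht => rw [map_add, map_add, hs, ht]

end Wedge

/-! ### Derivations of the localization -/

section Extend

variable {K O : Type*} [Field K] [CommRing O] [Algebra K O]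

/-- The derivations of a commutative algebra. -/
abbrev SelfDerivation (K R : Type*) [Field K] [CommRing R] [Algebra K R] : Type _ :=
  Derivation K R R

/-- `extendDer` as a derivation of an abstract commutative algebra: its type refers to the ring
structure of the localization only. -/
def locDer (D : Derivation K O O) (P : O) : SelfDerivation K (Localization.Away P) :=
  extendDer D P

theorem locDer_algebraMap (D : Derivation K O O) (P f : O) :
    locDer D P (algebraMap O (Localization.Away P) f) = algebraMap O _ (D f) :=
  extendDer_algebraMap D P f

theorem lTensor_extendDer {M : Type*} [AddCommGroup M] [Module K M]
    (D : Derivation K O O) (P : O) :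
    LinearMap.lTensor M (extendDer D P : Localization.Away P →ₗ[K] Localization.Away P) =
      LinearMap.lTensor M (locDer D P : Localization.Away P →ₗ[K] Localization.Away P) :=
  rfl

end Extend


/-! ### Application to the localization at `P` -/

namespace IsSplitting

variable {K g : Type*} [Field K] [CharZero K] [LieRing g] [LieAlgebra K g] [LieBialgebra K g]
  [FiniteDimensional K g] {l : LieSubbialgebra K g} {u : Submodule K g} (s : IsSplitting l u)

theorem contract_eq_contrR (P : DualFun l) (v : u) (t : (u ⊗[K] u) ⊗[K] Localization.Away P) :
    s.contract P v t =
      contrR ((s.omegaLoc (Localization.Away P)).compl₁₂ u.subtype u.subtype v) t :=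
  lTensor_lift_mul _ t

theorem dL_eq_dTensor (P : DualFun l) : dL P =
    dTensor (fun i => (stdBasis K l.toLieSubalgebra i : g))
      (fun i => locDer (leftTrans (K := K) (dualVec K l.toLieSubalgebra i)) P) :=
  rfl

-- Pushing the inverse from `u ⊗ u` to `g ⊗ g` keeps its contractions with `ω(v, ·)` equal to `v`
-- and makes those with `l^*` zero, which is all that the abstract equations require.
set_option maxHeartbeats 400000 in
theorem isPLDynamicalRMatrix_of_isInverse (hs : s.Nondegenerate) {ι : Type*} [Fintype ι]
    [DecidableEq ι] (b : Module.Basis ι K u)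
    (σ : wedge2 K u ⊗[K] Localization.Away (s.detOmega b))
    (hσ : ∀ v : u, contrR ((s.omegaLoc (Localization.Away (s.detOmega b))).compl₁₂
      u.subtype u.subtype v) (LinearMap.rTensor _ (wedge2 K u).subtype σ) = v ⊗ₜ 1) :
    IsPLDynamicalRMatrix l 0 (s.detOmega b)
      (LinearMap.rTensor _ (TensorProduct.mapIncl u u ∘ₗ (wedge2 K u).subtype) σ) := by
  have hmem := rTensor_map_mem_wedge2 u.subtype σ
  have hρ := rTensor_comm_of_mem_wedge2 hmem
  have hP := IsLocalization.Away.algebraMap_isUnit (S := Localization.Away (s.detOmega b))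
    (s.detOmega b)
  have hspan := s.span_testFunctionals (Localization.Away (s.detOmega b)) b hP
  have hω : ∀ v ∈ u, contrR (s.omegaLoc (Localization.Away (s.detOmega b)) v)
      (LinearMap.rTensor _ (TensorProduct.map u.subtype u.subtype ∘ₗ (wedge2 K u).subtype) σ) =
        v ⊗ₜ 1 := by
    intro v hv
    rw [LinearMap.rTensor_comp, LinearMap.comp_apply, contrR_rTensor_map]
    exact congrArg (LinearMap.rTensor _ u.subtype) (hσ ⟨v, hv⟩)
  have hl : ∀ ξ, contrR (s.dualLoc (Localization.Away (s.detOmega b)) ξ)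
      (LinearMap.rTensor _ (TensorProduct.map u.subtype u.subtype ∘ₗ (wedge2 K u).subtype) σ) =
        (0 : g) ⊗ₜ 1 := by
    intro ξ
    have h0 : s.dualLoc (Localization.Away (s.detOmega b)) ξ ∘ₗ u.subtype = 0 :=
      LinearMap.ext fun v => s.dualLoc_of_mem_u _ ξ v.2
    rw [LinearMap.rTensor_comp, LinearMap.comp_apply, contrR_rTensor_map, h0, contrR_zero,
      map_zero, TensorProduct.zero_tmul]
  refine ⟨s.detOmega_ne_zero hs b, hmem, fun a => ?_, ?_⟩
  · have h := (fun D hD => equivariant_of_contrR hspan hρ hω hl a D hD)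
      (locDer (dressL a) (s.detOmega b))
    have hD := locDer_algebraMap (dressL a) (s.detOmega b)
    replace h := h (by exact hD)
    rw [lTensor_extendDer]
    exact h
  · have h := (fun D hD => cdybe_of_contrR hspan hρ hω hl D hD)
      (fun i => locDer (leftTrans (dualVec K l.toLieSubalgebra i)) (s.detOmega b))
    replace h := h fun i => by exact locDer_algebraMap _ _
    rw [TensorProduct.zero_tmul, dL_eq_dTensor]
    exact h

end IsSplitting

end PLDyn

end

theorem mainTheorem1 {K g : Type*} [Field K] [CharZero K] [LieRing g] [LieAlgebra K g]
    [FiniteDimensional K g] [PLDyn.LieBialgebra K g]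
    (l : PLDyn.LieSubbialgebra K g) (u : Submodule K g) (s : PLDyn.IsSplitting l u)
    (hs : s.Nondegenerate)
    {ι : Type*} [Fintype ι] [DecidableEq ι] (b : Module.Basis ι K u) :
    ∃ σ : PLDyn.wedge2 K u ⊗[K] Localization.Away (s.detOmega b),
      s.IsInverse (s.detOmega b) (LinearMap.rTensor _ (PLDyn.wedge2 K u).subtype σ) ∧
      (∀ τ, s.IsInverse (s.detOmega b) τ →
        τ = LinearMap.rTensor _ (PLDyn.wedge2 K u).subtype σ) ∧
      PLDyn.IsPLDynamicalRMatrix l 0 (s.detOmega b)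
        (LinearMap.rTensor _ (TensorProduct.mapIncl u u ∘ₗ (PLDyn.wedge2 K u).subtype) σ) := by
  have hdet := s.isUnit_det_omegaLoc (Localization.Away (s.detOmega b)) b
    (IsLocalization.Away.algebraMap_isUnit (s.detOmega b))
  obtain ⟨t, ht⟩ := PLDyn.exists_contrR_eq b hdet
  -- The inverse matrix gives an inverse tensor; its antisymmetry, inherited from `ω`, lifts it to
  -- `∧²(u)` with coefficients.
  obtain ⟨σ, rfl⟩ := PLDyn.exists_wedge2_of_rTensor_comm (PLDyn.rTensor_comm_of_contrR b hdet
    (fun v w => s.omegaLoc_swap _ (v : g) (w : g)) ht)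
  refine ⟨σ, fun v => ?_, fun τ hτ => ?_, s.isPLDynamicalRMatrix_of_isInverse hs b σ ht⟩
  · rw [s.contract_eq_contrR, ht]
  · rw [← sub_eq_zero]
    refine PLDyn.eq_zero_of_contrR b hdet fun v => ?_
    rw [map_sub, ht, ← s.contract_eq_contrR, hτ v, sub_self]
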